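/- Let $R$ be a commutative ring whose nilradical $\mathcal N R$ is a nilpotent ideal and whose spectrum is connected. Give $R((u))((t))$ the topology in which the sets $t^mR((u))[[t]]+\sum_{i\in\mathbf Z}u^{m_i}t^iR[[u]]$ ($m, m_i\in\mathbf Z$) form a base of neighbourhoods of $0$, and order $\mathbf Z^2$ lexicographically. Every $f\in R((u))((t))^*$ has a unique decomposition $$f=f_0\,u^{\nu_2(f)}t^{\nu_1(f)}\prod_{(i,j)<(0,0)}(1-a_{i,j}u^jt^i)\prod_{(i,j)>(0,0)}(1-a_{i,j}u^jt^i)$$ with $f_0\in R^*$, $\nu_1(f),\nu_2(f)\in\mathbf Z$, $a_{i,j}\in R$, where for $(i,j)<(0,0)$ the $a_{i,j}$ are nilpotent and vanish unless $i>n$ and $j>m$ for some integers $n,m$ depending on $f$, and where both products converge. Put $\nu(f,g)=\nu_2(f)\nu_1(g)-\nu_2(g)\nu_1(f)$ and $$A(f,g,h)=\nu(f,g)\nu(f,h)+\nu(g,h)\nu(g,f)+\nu(h,f)\nu(h,g)+\nu(f,g)\nu(f,h)\nu(g,h).$$ Let $b_{k,l}$ and $c_{m,n}$ be the coefficients of the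 corresponding decompositions of $g$ and $h$. The two-dimensional Contou-Carrère symbol of $f,g,h\in R((u))((t))^*$ is the element $$(f,g,h)=(-1)^{A(f,g,h)}f_0^{\nu(g,h)}g_0^{\nu(h,f)}h_0^{\nu(f,g)}\prod T(a_{i,j},b_{k,l},c_{m,n})\prod S(a_{i,j},b_{k,l})^{\nu_1(h)}\prod Q(a_{i,j},b_{k,l})^{\nu_2(h)}$$ $$\times\prod S(c_{m,n},a_{i,j})^{\nu_1(g)}\prod Q(c_{m,n},a_{i,j})^{\nu_2(g)}\prod S(b_{k,l},c_{m,n})^{\nu_1(f)}\prod Q(b_{k,l},c_{m,n})^{\nu_2(f)}$$ of $R^*$, where the products run over all indices in $\mathbf Z^2\setminus\{(0,0)\}$ and have only finitely many factors $\ne1$. Here, with $p_0=lm-nk$, $q_0=ni-jm$, $r_0=jk-li$ and $d=\gcd(p_0,q_0,r_0)$ taken with the common sign of $p_0,q_0,r_0$, $$T(a_{i,j},b_{k,l},c_{m,n})=\bigl(1-a_{i,j}^{p_0/d}\,b_{k,l}^{q_0/d}\,c_{m,n}^{r_0/d}\bigr)^{d}$$ if $p_0,q_0,r_0$ are all positive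 or all negative, and $T=1$ otherwise. If $jk-li=0$, $jl+ik<0$ and $jl\neq0$, then, with $e=\gcd(j,l)>0$, $$S(a_{i,j},b_{k,l})=\bigl(1-a_{i,j}^{|l|/e}\,b_{k,l}^{|j|/e}\bigr)^{-\operatorname{sgn}(l)\,e};$$ otherwise $S=1$. If $jk-li=0$, $jl+ik<0$ and $ik\neq0$, then, with $e=\gcd(i,k)>0$, $$Q(a_{i,j},b_{k,l})=\bigl(1-a_{i,j}^{|k|/e}\,b_{k,l}^{|i|/e}\bigr)^{\operatorname{sgn}(k)\,e};$$ otherwise $Q=1$. Let $k$ be a field. (1) For $R=k$ the two-dimensional Contou-Carrère symbol is well defined and coincides with the two-dimensional tame symbol: for all $f,g,h\in k((u))((t))^*$, $$(f,g,h)=(-1)^{A(f,g,h)}\,f^{\nu(g,h)}g^{\nu(h,f)}h^{\nu(f,g)}\bmod t\bmod u,$$ where on the right-hand side $\nu_1(x)$ is the order of $x$ in $t$, $\nu_2(x)$ is the order in $u$ of the leading coefficient of $x$, and $\nu$ and $A$ are formed from these. (2) For $R=k[\epsilon]/\epsilon^4$ and all $f,g,h\in k((u))((t))$ the two-dimensional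 Contou-Carrère symbol of $1+\epsilon f$, $1+\epsilon g$, $1+\epsilon h$ is well defined and $$(1+\epsilon f,\,1+\epsilon g,\,1+\epsilon h)=1+\epsilon^3\operatorname{Res}(f\,dg\wedge dh),$$ where $dg\wedge dh=\left(\frac{\partial g}{\partial u}\frac{\partial h}{\partial t}-\frac{\partial h}{\partial u}\frac{\partial g}{\partial t}\right)du\wedge dt$ and $\operatorname{Res}\bigl(\sum a_{i,j}u^jt^i\,du\wedge dt\bigr)=a_{-1,-1}$. -/

import Mathlib

namespace ContouCarrere

open Function

/-- The ring `R((u))((t))`: Laurent series in `t` whose coefficients are Laurent series in `u`.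
The coefficient of `u ^ j * t ^ i` in `x` is `(x.coeff i).coeff j`. -/
abbrev DoubleLaurent (R : Type*) [CommRing R] : Type _ := LaurentSeries (LaurentSeries R)

section Symbol

variable {R : Type*} [CommRing R]

/-- The monomial `r * u ^ j * t ^ i`. -/
noncomputable def mono (i j : ℤ) (r : R) : DoubleLaurent R :=
  HahnSeries.single i (HahnSeries.single j r)

/-- Membership in the basic open neighbourhood of zero
`t ^ m * R((u))[[t]] + ∑ i, u ^ (n i) * t ^ i * R[[u]]` of the natural topology of `R((u))((t))`. -/
def InNbhd (m : ℤ) (n : ℤ → ℤ) (x : DoubleLaurent R) : Prop :=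
  ∀ i < m, ∀ j < n i, (x.coeff i).coeff j = 0

/-- The infinite product of the factors `1 - a (i, j) * u ^ j * t ^ i`, `(i, j) ∈ s`, converges
(unconditionally) to `x` in the natural topology of `R((u))((t))`. -/
def HasInfiniteProduct (s : Set (ℤ × ℤ)) (a : ℤ × ℤ → R) (x : DoubleLaurent R) : Prop :=
  ∀ (m : ℤ) (n : ℤ → ℤ), ∃ S : Finset (ℤ × ℤ), (S : Set (ℤ × ℤ)) ⊆ s ∧
    ∀ S' : Finset (ℤ × ℤ), S ⊆ S' → (S' : Set (ℤ × ℤ)) ⊆ s →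
      InNbhd m n (∏ p ∈ S', (1 - mono p.1 p.2 (a p)) - x)

/-- The pairs `(i, j)` below `(0, 0)` in the lexicographical order. -/
def negIdx : Set (ℤ × ℤ) := {p | p.1 < 0 ∨ (p.1 = 0 ∧ p.2 < 0)}

/-- The pairs `(i, j)` above `(0, 0)` in the lexicographical order. -/
def posIdx : Set (ℤ × ℤ) := {p | 0 < p.1 ∨ (p.1 = 0 ∧ 0 < p.2)}

/-- The canonical decomposition of an element of `R((u))((t))ˣ`, where `R` has a nilpotent
nilradical and a connected spectrum (so that the two valuations are integers):
`f = f₋₁ * f₀ * u ^ ν₂ * t ^ ν₁ * f₁` with `f₀ ∈ Rˣ`,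
`f₋₁ = ∏ (1 - a (i, j) * u ^ j * t ^ i)` over `(i, j) < (0, 0)` with nilpotent `a (i, j)` that
vanish unless `i` and `j` are bounded from below, and
`f₁ = ∏ (1 - a (i, j) * u ^ j * t ^ i)` over `(i, j) > (0, 0)`. -/
structure Decomposition (f : DoubleLaurent R) where
  ν₁ : ℤ
  ν₂ : ℤ
  unit : Rˣ
  a : ℤ × ℤ → R
  neg : DoubleLaurent R
  pos : DoubleLaurent R
  a_zero : a (0, 0) = 0
  a_nilpotent : ∀ p ∈ negIdx, IsNilpotent (a p)
  a_bounded : ∃ i₀ j₀ : ℤ, ∀ p ∈ negIdx, a p ≠ 0 → i₀ < p.1 ∧ j₀ < p.2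
  neg_eq : HasInfiniteProduct negIdx a neg
  pos_eq : HasInfiniteProduct posIdx a pos
  eq_mul : f = neg * mono ν₁ ν₂ (unit : R) * pos

/-- For `p = (i, j)` and `q = (k, l)` the determinant with rows `(j, l)` and `(i, k)`. -/
def det (p q : ℤ × ℤ) : ℤ := p.2 * q.1 - q.2 * p.1

/-- The exponent of the sign in the symbol of three elements whose pairs of valuations
`(ν₁, ν₂)` are `p`, `q`, `r`. -/
def signExp (p q r : ℤ × ℤ) : ℤ :=
  det p q * det p r + det q r * det q p + det r p * det r q + det p q * det p r * det q r

open Classical in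
/-- An invertible element of `R` as an element of `Rˣ`. It is only used for elements `1 - x` with
`x` nilpotent; the value `1` at non-invertible elements is irrelevant. -/
noncomputable def toUnit (x : R) : Rˣ := if h : IsUnit x then h.unit else 1

/-- The factor `T`: the symbol of `1 - a * u ^ j * t ^ i`, `1 - b * u ^ l * t ^ k`,
`1 - c * u ^ n * t ^ m`, where `p = (i, j)`, `q = (k, l)`, `r = (m, n)`. -/
noncomputable def factorT (p q r : ℤ × ℤ) (a b c : R) : Rˣ :=
  let p₀ := det q r
  let q₀ := det r p
  let r₀ := det p q
  let d : ℕ := Nat.gcd p₀.natAbs (Nat.gcd q₀.natAbs r₀.natAbs)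
  let x : Rˣ := toUnit (1 - a ^ (p₀.natAbs / d) * b ^ (q₀.natAbs / d) * c ^ (r₀.natAbs / d))
  if 0 < p₀ ∧ 0 < q₀ ∧ 0 < r₀ then x ^ (d : ℤ)
  else if p₀ < 0 ∧ q₀ < 0 ∧ r₀ < 0 then x ^ (-(d : ℤ))
  else 1

/-- The factor `S`: the symbol of `1 - a * u ^ j * t ^ i`, `1 - b * u ^ l * t ^ k`, `t`,
where `p = (i, j)`, `q = (k, l)`. -/
noncomputable def factorS (p q : ℤ × ℤ) (a b : R) : Rˣ :=
  let d : ℕ := Int.gcd p.2 q.2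
  if det p q = 0 ∧ p.2 * q.2 + p.1 * q.1 < 0 ∧ p.2 * q.2 ≠ 0 then
    toUnit (1 - a ^ (q.2.natAbs / d) * b ^ (p.2.natAbs / d)) ^ (-(q.2.sign * (d : ℤ)))
  else 1

/-- The factor `Q`: the symbol of `1 - a * u ^ j * t ^ i`, `1 - b * u ^ l * t ^ k`, `u`,
where `p = (i, j)`, `q = (k, l)`. -/
noncomputable def factorQ (p q : ℤ × ℤ) (a b : R) : Rˣ :=
  let d : ℕ := Int.gcd p.1 q.1
  if det p q = 0 ∧ p.2 * q.2 + p.1 * q.1 < 0 ∧ p.1 * q.1 ≠ 0 then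
    toUnit (1 - a ^ (q.1.natAbs / d) * b ^ (p.1.natAbs / d)) ^ (q.1.sign * (d : ℤ))
  else 1

/-- All factors `T` of three families of coefficients. -/
noncomputable def famT (a b c : ℤ × ℤ → R) (x : (ℤ × ℤ) × (ℤ × ℤ) × (ℤ × ℤ)) : Rˣ :=
  factorT x.1 x.2.1 x.2.2 (a x.1) (b x.2.1) (c x.2.2)

/-- All factors `S` of two families of coefficients. -/
noncomputable def famS (a b : ℤ × ℤ → R) (x : (ℤ × ℤ) × (ℤ × ℤ)) : Rˣ :=
  factorS x.1 x.2 (a x.1) (b x.2)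

/-- All factors `Q` of two families of coefficients. -/
noncomputable def famQ (a b : ℤ × ℤ → R) (x : (ℤ × ℤ) × (ℤ × ℤ)) : Rˣ :=
  factorQ x.1 x.2 (a x.1) (b x.2)

namespace Decomposition

variable {f g h : DoubleLaurent R}

/-- The pair of valuations `(ν₁, ν₂)`. -/
def ν (F : Decomposition f) : ℤ × ℤ := (F.ν₁, F.ν₂)

/-- The infinite products in the explicit formula have only finitely many factors `≠ 1`. -/
def FiniteFactors (F : Decomposition f) (G : Decomposition g) (H : Decomposition h) : Prop :=
  (mulSupport (famT F.a G.a H.a)).Finite ∧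
  (mulSupport (famS F.a G.a)).Finite ∧ (mulSupport (famQ F.a G.a)).Finite ∧
  (mulSupport (famS H.a F.a)).Finite ∧ (mulSupport (famQ H.a F.a)).Finite ∧
  (mulSupport (famS G.a H.a)).Finite ∧ (mulSupport (famQ G.a H.a)).Finite

/-- The explicit formula for the symbol. (A factor with an index `(0, 0)` equals `1`.) -/
noncomputable def symbol (F : Decomposition f) (G : Decomposition g) (H : Decomposition h) : Rˣ :=
  (-1) ^ signExp F.ν G.ν H.ν *
    (F.unit ^ det G.ν H.ν * G.unit ^ det H.ν F.ν * H.unit ^ det F.ν G.ν) *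
    (∏ᶠ x, famT F.a G.a H.a x) *
    ((∏ᶠ x, famS F.a G.a x ^ H.ν₁) * (∏ᶠ x, famQ F.a G.a x ^ H.ν₂)) *
    ((∏ᶠ x, famS H.a F.a x ^ G.ν₁) * (∏ᶠ x, famQ H.a F.a x ^ G.ν₂)) *
    ((∏ᶠ x, famS G.a H.a x ^ F.ν₁) * (∏ᶠ x, famQ G.a H.a x ^ F.ν₂))

end Decomposition

/-- `c` is a value of the explicit formula at `(f, g, h)`. -/
def IsSymbolValue (f g h : (DoubleLaurent R)ˣ) (c : Rˣ) : Prop :=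
  ∃ (F : Decomposition (f : DoubleLaurent R)) (G : Decomposition (g : DoubleLaurent R))
    (H : Decomposition (h : DoubleLaurent R)), F.FiniteFactors G H ∧ c = F.symbol G H

/-- The two-dimensional Contou-Carrère symbol `(f, g, h)`. It is defined by the explicit formula
where `∃! c, IsSymbolValue f g h c`. -/
noncomputable def symbol (f g h : (DoubleLaurent R)ˣ) : Rˣ :=
  Classical.epsilon (IsSymbolValue f g h)

end Symbol

section Tame

variable {k : Type*} [Field k]

/-- The rank two valuation `(ν₁, ν₂)` of `x ∈ k((u))((t))ˣ`: the order of `x` in `t`, and the order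
in `u` of the leading coefficient. -/
noncomputable def val (x : DoubleLaurent k) : ℤ × ℤ := (x.order, x.leadingCoeff.order)

/-- The two-dimensional tame symbol: the sign times
`f ^ ν(g, h) * g ^ ν(h, f) * h ^ ν(f, g)` reduced modulo `t` and then modulo `u`. -/
noncomputable def tameSymbol (f g h : (DoubleLaurent k)ˣ) : k :=
  let vf := val (f : DoubleLaurent k)
  let vg := val (g : DoubleLaurent k)
  let vh := val (h : DoubleLaurent k)
  let w : (DoubleLaurent k)ˣ := f ^ det vg vh * g ^ det vh vf * h ^ det vf vg
  (((-1 : kˣ) ^ signExp vf vg vh : kˣ) : k) * ((w : DoubleLaurent k).coeff 0).coeff 0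

end Tame

section Residue

variable {k : Type*} [Field k]

/-- `∂/∂t` on `k((u))((t))`. -/
noncomputable def derivT (x : DoubleLaurent k) : DoubleLaurent k := LaurentSeries.derivative k x

/-- `∂/∂u` on `k((u))((t))`: the derivative of every coefficient. -/
noncomputable def derivU (x : DoubleLaurent k) : DoubleLaurent k :=
  HahnSeries.map x (LaurentSeries.derivative k : LaurentSeries k →ₗ[k] LaurentSeries k)

/-- `Res (f dg ∧ dh)`: the coefficient of `u⁻¹ t⁻¹ du ∧ dt`. -/
noncomputable def resWedge (f g h : DoubleLaurent k) : k :=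
  ((f * (derivU g * derivT h - derivU h * derivT g)).coeff (-1)).coeff (-1)

/-- `k[ε]/ε⁴`. -/
abbrev Trunc (k : Type*) [Field k] : Type _ := AdjoinRoot (Polynomial.X ^ 4 : Polynomial k)

/-- The class of `ε` in `k[ε]/ε⁴`. -/
noncomputable def eps (k : Type*) [Field k] : Trunc k := AdjoinRoot.root _

/-- The inclusion `k((u))((t)) → (k[ε]/ε⁴)((u))((t))`, coefficient by coefficient. -/
noncomputable def extend (x : DoubleLaurent k) : DoubleLaurent (Trunc k) where
  coeff i := HahnSeries.map (x.coeff i) (algebraMap k (Trunc k))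
  isPWO_support' := x.isPWO_support.mono fun i hi h0 => hi (by
    ext j
    simp [show x.coeff i = 0 from h0])

theorem eps_pow_four (k : Type*) [Field k] : eps k ^ 4 = 0 := by
  have h := AdjoinRoot.eval₂_root (Polynomial.X ^ 4 : Polynomial k)
  simpa [eps] using h

theorem isNilpotent_eps_mul (x : DoubleLaurent (Trunc k)) :
    IsNilpotent (HahnSeries.C (HahnSeries.C (eps k)) * x) :=
  ⟨4, by rw [mul_pow, ← map_pow, ← map_pow, eps_pow_four]; simp⟩

/-- The invertible element `1 + ε f` of `(k[ε]/ε⁴)((u))((t))`, for `f ∈ k((u))((t))`. -/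
noncomputable def oneAddEps (f : DoubleLaurent k) : (DoubleLaurent (Trunc k))ˣ :=
  (isNilpotent_eps_mul (extend f)).isUnit_one_add.unit

end Residue

end ContouCarrere

/-!
All computations are done with the coefficients at the indices in `ℤ × ℤ`, ordered
lexicographically. The support of an element of `R((u))((t))` is well ordered, which turns products
into finite sums and makes it possible to solve for the coefficients `a (i, j)` of a product over
the positive indices one after the other, each `a q` being determined by the coefficient at `q`.
Over a ring with nilpotent nilradical a series is first factored modulo the nilradical, and the
factors over the negative indices are then found by successive approximation.

Over a field, every coefficient below `(0, 0)` is nilpotent, hence zero, and two positive indices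
never satisfy the linear relation that a nontrivial factor `T`, `S` or `Q` requires. All of these
factors are therefore `1`, and the symbol is the tame symbol of the leading coefficients.

For `f`, `g`, `h` congruent to `1` modulo an ideal `I` with `I ^ 4 = 0`, the valuations vanish and
`a q` is the negative of the coefficient at `q`, modulo `I ^ 2`. A factor `T` is `1` unless the
exponents of `a`, `b`, `c` are all `1`, that is, unless the three indices have sum zero. It is then
`1` plus an element of `I ^ 3`, which is the corresponding term of the expansion of
`Res (f dg ∧ dh)`. Since `I ^ 3 * I ^ 3 = 0`, the product of these factors is `1` plus their sum.
-/

namespace ContouCarrere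

open Function

section IndexSet

variable {s t V : Set (ℤ × ℤ)} {p q : ℤ × ℤ} {T : Finset (ℤ × ℤ)}

theorem mem_posIdx_iff : q ∈ posIdx ↔ 0 < toLex q := by
  rw [Prod.Lex.lt_iff]
  simp [posIdx, eq_comm]

theorem mem_negIdx_iff : q ∈ negIdx ↔ toLex q < 0 := by
  rw [Prod.Lex.lt_iff]
  simp [negIdx]

theorem toLex_lt_toLex_iff : toLex p < toLex q ↔ q - p ∈ posIdx := by
  rw [mem_posIdx_iff, toLex_sub, sub_pos]

theorem mem_negIdx_or_eq_zero_or_mem_posIdx (q : ℤ × ℤ) : q ∈ negIdx ∨ q = 0 ∨ q ∈ posIdx := by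
  rw [mem_posIdx_iff, mem_negIdx_iff]
  exact lt_trichotomy (toLex q) 0

theorem zero_notMem_posIdx : (0 : ℤ × ℤ) ∉ posIdx := by simp [posIdx]

theorem zero_notMem_negIdx : (0 : ℤ × ℤ) ∉ negIdx := by simp [negIdx]

theorem notMem_negIdx_of_mem_posIdx (h : q ∈ posIdx) : q ∉ negIdx := by
  rw [mem_negIdx_iff]
  exact (mem_posIdx_iff.1 h).not_gt

theorem sum_mem_posIdx (hT : T.Nonempty) (h : ∀ p ∈ T, p ∈ posIdx) : ∑ p ∈ T, p ∈ posIdx := by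
  simp only [mem_posIdx_iff] at h ⊢
  exact Finset.sum_pos h hT

theorem sum_sub_mem_posIdx (h : ∀ p ∈ T, p ∈ posIdx) (hp : p ∈ T) (hT : T ≠ {p}) :
    ∑ p ∈ T, p - p ∈ posIdx := by
  rw [← Finset.add_sum_erase T (fun p => p) hp, add_sub_cancel_left]
  refine sum_mem_posIdx ?_ fun q hq => h q (Finset.mem_of_mem_erase hq)
  rw [Finset.nonempty_iff_ne_empty, Ne, Finset.erase_eq_empty_iff]
  exact not_or.2 ⟨Finset.ne_empty_of_mem hp, hT⟩

/-- The set `V` is well ordered by the lexicographical order, as the supports of the elements of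
`R((u))((t))` are. -/
def IsLexPWO (V : Set (ℤ × ℤ)) : Prop := (ofLex ⁻¹' V : Set (ℤ ×ₗ ℤ)).IsPWO

theorem IsLexPWO.mono (ht : IsLexPWO t) (h : s ⊆ t) : IsLexPWO s := Set.IsPWO.mono ht fun _ => @h _

theorem isPWO_int_iff_bddBelow {A : Set ℤ} : A.IsPWO ↔ BddBelow A := by
  refine ⟨fun h => ?_, fun h => h.isWF.isPWO⟩
  rcases A.eq_empty_or_nonempty with rfl | hne
  · exact bddBelow_empty
  · exact ⟨h.isWF.min hne, fun a ha => h.isWF.min_le hne ha⟩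

theorem isLexPWO_iff :
    IsLexPWO V ↔ BddBelow (Prod.fst '' V) ∧ ∀ i, BddBelow {j | (i, j) ∈ V} := by
  simp only [IsLexPWO, Set.PartiallyWellOrderedOn.ProdLex_iff, isPWO_int_iff_bddBelow]
  have : (fun x : ℤ ×ₗ ℤ => (ofLex x).1) '' (ofLex ⁻¹' V) = Prod.fst '' V := by
    ext i
    simp
  rw [this]
  rfl

theorem isLexPWO_of_finite (hV : V.Finite) : IsLexPWO V :=
  (hV.preimage ofLex.injective.injOn).isPWO

theorem isLexPWO_of_bounded {i₀ j₀ : ℤ} (h : ∀ q ∈ V, i₀ ≤ q.1 ∧ j₀ ≤ q.2) : IsLexPWO V :=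
  isLexPWO_iff.2 ⟨⟨i₀, by rintro _ ⟨q, hq, rfl⟩; exact (h q hq).1⟩, fun _ => ⟨j₀, fun _ hj =>
    (h _ hj).2⟩⟩

theorem IsLexPWO.finite_inter_region (hV : IsLexPWO V) (m : ℤ) (n : ℤ → ℤ) :
    {q | q ∈ V ∧ q.1 < m ∧ q.2 < n q.1}.Finite := by
  obtain ⟨⟨i₀, hi₀⟩, h⟩ := isLexPWO_iff.1 hV
  choose j₀ hj₀ using h
  refine (Set.Finite.biUnion (Set.finite_Ico i₀ m)
    fun i _ => (Set.finite_singleton i).prod (Set.finite_Ico (j₀ i) (n i))).subset ?_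
  rintro q ⟨hq, hqm, hqn⟩
  exact Set.mem_biUnion (Set.mem_Ico.2 ⟨hi₀ ⟨q, hq, rfl⟩, hqm⟩) ⟨rfl, hj₀ _ hq, hqn⟩

theorem IsLexPWO.finite_addAntidiagonal (hs : IsLexPWO s) (ht : IsLexPWO t) (q : ℤ × ℤ) :
    {p | p ∈ s ∧ q - p ∈ t}.Finite := by
  refine ((Set.AddAntidiagonal.finite_of_isPWO hs ht (toLex q)).image
    fun z => ofLex z.1).subset ?_
  rintro p ⟨h1, h2⟩
  refine ⟨(toLex p, toLex (q - p)), ⟨h1, h2, ?_⟩, rfl⟩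
  rw [← toLex_add, add_sub_cancel]

theorem IsLexPWO.exists_minimal (hV : IsLexPWO V) (hne : V.Nonempty) :
    ∃ q ∈ V, ∀ p ∈ V, q - p ∉ posIdx := by
  have hne' : (ofLex ⁻¹' V : Set (ℤ ×ₗ ℤ)).Nonempty := hne
  refine ⟨ofLex (hV.isWF.min hne'), hV.isWF.min_mem hne', fun p hp hlt => ?_⟩
  exact (toLex_lt_toLex_iff.2 hlt).not_ge (hV.isWF.min_le hne' (a := toLex p) hp)

end IndexSet

section Coefficients

variable {R : Type*} [CommRing R]

/-- The coefficient of `u ^ q.2 * t ^ q.1` as an additive function on `R((u))((t))`. -/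
noncomputable def biCoeff (q : ℤ × ℤ) : DoubleLaurent R →+ R where
  toFun x := (x.coeff q.1).coeff q.2
  map_zero' := by simp
  map_add' x y := by simp

theorem biCoeff_apply (q : ℤ × ℤ) (x : DoubleLaurent R) :
    biCoeff q x = (x.coeff q.1).coeff q.2 := rfl

theorem ext_biCoeff {x y : DoubleLaurent R} (h : ∀ q, biCoeff q x = biCoeff q y) : x = y := by
  ext i j
  exact h (i, j)

theorem biCoeff_mono (q : ℤ × ℤ) (i j : ℤ) (r : R) :
    biCoeff q (mono i j r) = if q = (i, j) then r else 0 := by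
  classical
  simp only [biCoeff_apply, mono, HahnSeries.coeff_single, Prod.ext_iff]
  by_cases h : q.1 = i <;> by_cases h' : q.2 = j <;> simp [h, h']

theorem one_eq_mono : (1 : DoubleLaurent R) = mono 0 0 1 := rfl

theorem biCoeff_one (q : ℤ × ℤ) : biCoeff q (1 : DoubleLaurent R) = if q = 0 then 1 else 0 :=
  biCoeff_mono q 0 0 1

theorem mono_mul_mono (i j k l : ℤ) (r s : R) :
    mono i j r * mono k l s = mono (i + k) (j + l) (r * s) := by
  simp [mono, HahnSeries.single_mul_single]

theorem mono_zero (i j : ℤ) : mono i j (0 : R) = 0 := by simp [mono]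

theorem mono_neg (i j : ℤ) (r : R) : mono i j (-r) = -mono i j r := by simp [mono]

theorem mono_sub (i j : ℤ) (r s : R) : mono i j (r - s) = mono i j r - mono i j s := by
  simp [mono]

theorem prod_mono (T : Finset (ℤ × ℤ)) (a : ℤ × ℤ → R) :
    ∏ p ∈ T, mono p.1 p.2 (a p) = mono (∑ p ∈ T, p).1 (∑ p ∈ T, p).2 (∏ p ∈ T, a p) := by
  induction T using Finset.cons_induction with
  | empty => exact one_eq_mono
  | cons p T hp ih => simp only [Finset.prod_cons, Finset.sum_cons, ih, mono_mul_mono, Prod.fst_add,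
      Prod.snd_add]

theorem biCoeff_mono_mul (q : ℤ × ℤ) (i j : ℤ) (r : R) (x : DoubleLaurent R) :
    biCoeff q (mono i j r * x) = r * biCoeff (q - (i, j)) x := by
  have := HahnSeries.coeff_single_mul (r := HahnSeries.single j r) (x := x) (a := q.1) (b := i)
  rw [biCoeff_apply, mono, this, HahnSeries.coeff_single_mul]
  rfl

theorem isLexPWO_support (x : DoubleLaurent R) : IsLexPWO {q | biCoeff q x ≠ 0} :=
  (HahnSeries.ofIterate x).isPWO_support

/-- The series with prescribed coefficients on a well ordered set of indices. -/
noncomputable def ofCoeff (c : ℤ × ℤ → R) (h : IsLexPWO (support c)) : DoubleLaurent R :=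
  HahnSeries.toIterate ⟨fun q => c (ofLex q), h⟩

/-- The sum of the terms of a series with index in `s`. -/
noncomputable def restrict (s : Set (ℤ × ℤ)) (x : DoubleLaurent R) : DoubleLaurent R :=
  ofCoeff (s.indicator fun q => biCoeff q x) <| (isLexPWO_support x).mono fun _ =>
    fun hq h => hq (Set.indicator_apply_eq_zero.2 fun _ => h)

theorem biCoeff_restrict (s : Set (ℤ × ℤ)) (x : DoubleLaurent R) (q : ℤ × ℤ) :
    biCoeff q (restrict s x) = s.indicator (fun q => biCoeff q x) q := rfl

theorem finite_support_mul (x y : DoubleLaurent R) (q : ℤ × ℤ) :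
    (support fun p => biCoeff p x * biCoeff (q - p) y).Finite :=
  ((isLexPWO_support x).finite_addAntidiagonal (isLexPWO_support y) q).subset fun _ hp =>
    ⟨left_ne_zero_of_mul hp, right_ne_zero_of_mul hp⟩

theorem coeff_mul_eq_finsum {A : Type*} [CommRing A] (x y : LaurentSeries A) (i : ℤ) :
    (x * y).coeff i = ∑ᶠ a, x.coeff a * y.coeff (i - a) := by
  rw [HahnSeries.coeff_mul, finsum_eq_sum_of_support_subset (s := (Finset.antidiagonal
    x.isPWO_support y.isPWO_support i).image Prod.fst), Finset.sum_image]
  · refine Finset.sum_congr rfl fun z hz => ?_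
    rw [← (Finset.mem_antidiagonal.1 hz).2.2, add_sub_cancel_left]
  · intro z hz w hw h
    have h1 := (Finset.mem_antidiagonal.1 hz).2.2
    have h2 := (Finset.mem_antidiagonal.1 hw).2.2
    exact Prod.ext h (by linarith [show z.1 = w.1 from h])
  · intro a ha
    rw [mem_support] at ha
    refine Finset.mem_coe.2 (Finset.mem_image.2 ⟨(a, i - a), ?_, rfl⟩)
    exact Finset.mem_antidiagonal.2 ⟨left_ne_zero_of_mul ha, right_ne_zero_of_mul ha, by simp⟩

theorem biCoeff_mul (x y : DoubleLaurent R) (q : ℤ × ℤ) :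
    biCoeff q (x * y) = ∑ᶠ p, biCoeff p x * biCoeff (q - p) y := by
  rw [finsum_curry _ (finite_support_mul x y q), biCoeff_apply, coeff_mul_eq_finsum]
  have hfin : (support fun a => x.coeff a * y.coeff (q.1 - a)).Finite := by
    refine (Set.AddAntidiagonal.finite_of_isPWO x.isPWO_support y.isPWO_support q.1).image
      Prod.fst |>.subset fun a ha => ⟨(a, q.1 - a), ⟨left_ne_zero_of_mul ha,
        right_ne_zero_of_mul ha, by simp⟩, rfl⟩
  refine ((HahnSeries.coeff.addMonoidHom (Γ := ℤ) (R := R) q.2).map_finsum hfin).trans ?_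
  exact finsum_congr fun a => coeff_mul_eq_finsum _ _ _

/-- The series whose coefficients all lie in an ideal of the ring of constants. -/
def coeffIdeal (I : Ideal R) : Ideal (DoubleLaurent R) where
  carrier := {x | ∀ q, biCoeff q x ∈ I}
  zero_mem' q := by simp
  add_mem' hx hy q := by rw [map_add]; exact I.add_mem (hx q) (hy q)
  smul_mem' c x hx q := by
    rw [smul_eq_mul, biCoeff_mul]
    exact finsum_induction (· ∈ I) I.zero_mem (fun _ _ => I.add_mem)
      fun p => I.mul_mem_left _ (hx _)

theorem mul_mem_coeffIdeal {I J K : Ideal R} (h : I * J ≤ K) {x y : DoubleLaurent R}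
    (hx : x ∈ coeffIdeal I) (hy : y ∈ coeffIdeal J) : x * y ∈ coeffIdeal K := fun q => by
  rw [biCoeff_mul]
  exact finsum_induction (· ∈ K) K.zero_mem (fun _ _ => K.add_mem)
    fun p => h (Ideal.mul_mem_mul (hx _) (hy _))

theorem coeffIdeal_mono {I J : Ideal R} (h : I ≤ J) : coeffIdeal I ≤ coeffIdeal J :=
  fun _ hx q => h (hx q)

theorem mono_mem_coeffIdeal {I : Ideal R} {r : R} (hr : r ∈ I) (i j : ℤ) :
    mono i j r ∈ coeffIdeal I := fun q => by
  rw [biCoeff_mono]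
  split_ifs
  exacts [hr, I.zero_mem]

theorem biCoeff_mul_of_notMem_posIdx {x y : DoubleLaurent R}
    (hx : ∀ q ∈ negIdx, biCoeff q x = 0) (hy : ∀ q ∈ negIdx, biCoeff q y = 0) {q : ℤ × ℤ}
    (hq : q ∉ posIdx) : biCoeff q (x * y) = biCoeff 0 x * biCoeff q y := by
  rw [biCoeff_mul, finsum_eq_single _ 0, sub_zero]
  intro p hp0
  rcases mem_negIdx_or_eq_zero_or_mem_posIdx p with hp | hp | hp
  · rw [hx p hp, zero_mul]
  · exact absurd hp hp0
  · rw [hy (q - p), mul_zero]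
    simp only [mem_posIdx_iff, mem_negIdx_iff, not_lt, toLex_sub, sub_neg] at *
    exact hq.trans_lt hp

/-- The series without terms below `(0, 0)`. -/
def nonnegSubring (R : Type*) [CommRing R] : Subring (DoubleLaurent R) where
  carrier := {x | ∀ q ∈ negIdx, biCoeff q x = 0}
  zero_mem' q _ := map_zero _
  one_mem' q hq := by rw [biCoeff_one, if_neg (ne_of_mem_of_not_mem hq zero_notMem_negIdx)]
  add_mem' hx hy q hq := by rw [map_add, hx q hq, hy q hq, add_zero]
  neg_mem' hx q hq := by rw [map_neg, hx q hq, neg_zero]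
  mul_mem' hx hy q hq := by
    rw [biCoeff_mul_of_notMem_posIdx hx hy fun h => notMem_negIdx_of_mem_posIdx h hq, hy q hq,
      mul_zero]

theorem mono_mem_nonnegSubring {p : ℤ × ℤ} (hp : p ∉ negIdx) (r : R) :
    mono p.1 p.2 r ∈ nonnegSubring R := fun _ hq => by
  rw [biCoeff_mono, if_neg]
  rintro rfl
  exact hp hq

end Coefficients

section Convergence

variable {R : Type*} [CommRing R] {s t : Set (ℤ × ℤ)} {a b : ℤ × ℤ → R} {x y : DoubleLaurent R}
  {q : ℤ × ℤ} {S T : Finset (ℤ × ℤ)}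

/-- The finite product of the factors `1 - a (i, j) * u ^ j * t ^ i`, `(i, j) ∈ S`. -/
noncomputable def partialProd (a : ℤ × ℤ → R) (S : Finset (ℤ × ℤ)) : DoubleLaurent R :=
  ∏ p ∈ S, (1 - mono p.1 p.2 (a p))

/-- The finite subsets `T` of `s` with sum `q`. They index the terms of the expansion of
`∏ p ∈ s, (1 - a p * u ^ p.2 * t ^ p.1)` that contribute to the coefficient at `q`. -/
def subsetsWithSum (s : Set (ℤ × ℤ)) (q : ℤ × ℤ) : Set (Finset (ℤ × ℤ)) :=
  {T | (T : Set (ℤ × ℤ)) ⊆ s ∧ ∑ p ∈ T, p = q}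

/-- The coefficient of the term with index `T` in the expansion of a product of factors
`1 - a p * u ^ p.2 * t ^ p.1`. -/
def expansionTerm (a : ℤ × ℤ → R) (T : Finset (ℤ × ℤ)) : R := (-1) ^ T.card * ∏ p ∈ T, a p

/-- The coefficient at `q` of the formal expansion of `∏ p ∈ s, (1 - a p * u ^ p.2 * t ^ p.1)`. -/
noncomputable def expansionCoeff (s : Set (ℤ × ℤ)) (a : ℤ × ℤ → R) (q : ℤ × ℤ) : R :=
  ∑ᶠ T ∈ subsetsWithSum s q, expansionTerm a T

theorem ne_zero_of_expansionTerm_ne_zero (h : expansionTerm a T ≠ 0) {p : ℤ × ℤ} (hp : p ∈ T) :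
    a p ≠ 0 := fun h0 => right_ne_zero_of_mul h (Finset.prod_eq_zero hp h0)

theorem biCoeff_partialProd (S : Finset (ℤ × ℤ)) (a : ℤ × ℤ → R) (q : ℤ × ℤ) :
    biCoeff q (partialProd a S) = expansionCoeff S a q := by
  have hexp : partialProd a S =
      ∑ T ∈ S.powerset, mono (∑ p ∈ T, p).1 (∑ p ∈ T, p).2 (expansionTerm a T) := by
    simp_rw [partialProd, sub_eq_neg_add, Finset.prod_add, Finset.prod_const_one, mul_one,
      ← mono_neg, prod_mono, Finset.prod_neg, expansionTerm]
  have hset : subsetsWithSum S q = ↑(S.powerset.filter fun T => ∑ p ∈ T, p = q) := by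
    ext T
    simp [subsetsWithSum]
  rw [expansionCoeff, hset, finsum_mem_coe_finset, hexp, map_sum, Finset.sum_filter]
  refine Finset.sum_congr rfl fun T _ => ?_
  rw [biCoeff_mono]
  exact if_congr eq_comm rfl rfl

theorem expansionCoeff_eq_of_subset (hst : s ⊆ t)
    (h : ∀ T ∈ subsetsWithSum t q, expansionTerm a T ≠ 0 → (T : Set (ℤ × ℤ)) ⊆ s) :
    expansionCoeff s a q = expansionCoeff t a q := by
  refine finsum_mem_inter_support_eq _ _ _ (Set.ext fun T => ?_)
  exact ⟨fun hT => ⟨⟨hT.1.1.trans hst, hT.1.2⟩, hT.2⟩, fun hT => ⟨⟨h T hT.1 hT.2, hT.1.2⟩, hT.2⟩⟩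

theorem HasInfiniteProduct.congr (hab : ∀ p ∈ s, a p = b p) (h : HasInfiniteProduct s a x) :
    HasInfiniteProduct s b x := fun m n => by
  obtain ⟨S, hS, h⟩ := h m n
  refine ⟨S, hS, fun S' hSS' hS' => ?_⟩
  have heq : ∏ p ∈ S', (1 - mono p.1 p.2 (b p)) = ∏ p ∈ S', (1 - mono p.1 p.2 (a p)) :=
    Finset.prod_congr rfl fun p hp => by rw [hab p (hS' hp)]
  exact heq ▸ h S' hSS' hS'

theorem HasInfiniteProduct.exists_biCoeff_eq (h : HasInfiniteProduct s a x) (q : ℤ × ℤ) :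
    ∃ S : Finset (ℤ × ℤ), (S : Set (ℤ × ℤ)) ⊆ s ∧
      ∀ S' : Finset (ℤ × ℤ), S ⊆ S' → (S' : Set (ℤ × ℤ)) ⊆ s →
        biCoeff q x = biCoeff q (partialProd a S') := by
  obtain ⟨S, hS, h⟩ := h (q.1 + 1) fun _ => q.2 + 1
  refine ⟨S, hS, fun S' hSS' hS' => ?_⟩
  have := h S' hSS' hS' q.1 (by simp) q.2 (by simp)
  rw [← biCoeff_apply, map_sub, sub_eq_zero] at this
  exact this.symm

theorem HasInfiniteProduct.unique (hx : HasInfiniteProduct s a x) (hy : HasInfiniteProduct s a y) :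
    x = y := by
  classical
  refine ext_biCoeff fun q => ?_
  obtain ⟨S, hS, h⟩ := hx.exists_biCoeff_eq q
  obtain ⟨S', hS', h'⟩ := hy.exists_biCoeff_eq q
  have hu : ((S ∪ S' : Finset (ℤ × ℤ)) : Set (ℤ × ℤ)) ⊆ s := by
    rw [Finset.coe_union]
    exact Set.union_subset hS hS'
  rw [h _ Finset.subset_union_left hu, h' _ Finset.subset_union_right hu]

theorem hasInfiniteProduct_zero : HasInfiniteProduct s (0 : ℤ × ℤ → R) 1 :=
  fun m n => ⟨∅, by simp, fun S _ _ i _ j _ => by simp [mono_zero]⟩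

/-- The formal expansion of an infinite product defines an element of `R((u))((t))`: every
coefficient has finitely many non-zero terms, and the exponents that occur are well ordered. -/
structure SummableExpansion (s : Set (ℤ × ℤ)) (a : ℤ × ℤ → R) : Prop where
  isLexPWO : IsLexPWO {q | ∃ T ∈ subsetsWithSum s q, expansionTerm a T ≠ 0}
  finite : ∀ q, {T ∈ subsetsWithSum s q | expansionTerm a T ≠ 0}.Finite

theorem SummableExpansion.hasInfiniteProduct (h : SummableExpansion s a)
    (hx : ∀ q, biCoeff q x = expansionCoeff s a q) : HasInfiniteProduct s a x := fun m n => by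
  classical
  have hfin := (h.isLexPWO.finite_inter_region m n).biUnion fun q _ => h.finite q
  have hmem : ∀ {T}, T ∈ hfin.toFinset → (T : Set (ℤ × ℤ)) ⊆ s := fun hT => by
    obtain ⟨q, -, hT⟩ := Set.mem_iUnion₂.1 (hfin.mem_toFinset.1 hT)
    exact hT.1.1
  refine ⟨hfin.toFinset.biUnion id, fun p hp => ?_, fun S hS hSs i hi j hj => ?_⟩
  · obtain ⟨T, hT, hp⟩ := Finset.mem_biUnion.1 hp
    exact hmem hT hp
  · rw [← biCoeff_apply (i, j), map_sub, hx, sub_eq_zero]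
    refine (biCoeff_partialProd S a _).trans (expansionCoeff_eq_of_subset hSs fun T hT hT0 => ?_)
    have hT' : T ∈ hfin.toFinset := hfin.mem_toFinset.2 <|
      Set.mem_biUnion ⟨⟨T, hT, hT0⟩, hi, hj⟩ ⟨hT, hT0⟩
    exact (Finset.subset_biUnion_of_mem id hT').trans hS

theorem SummableExpansion.exists_hasInfiniteProduct (h : SummableExpansion s a) :
    ∃ x, HasInfiniteProduct s a x :=
  ⟨ofCoeff (expansionCoeff s a) <| h.isLexPWO.mono fun _ => exists_ne_zero_of_finsum_mem_ne_zero,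
    h.hasInfiniteProduct fun _ => rfl⟩

end Convergence

section NegativeProducts

variable {R : Type*} [CommRing R] {I J : Ideal R} {a b : ℤ × ℤ → R} {T : Finset (ℤ × ℤ)} {N : ℕ}

/-- The families of coefficients of products over the negative indices: they lie in the ideal `I`
(nilpotent in the applications) and vanish unless both indices are bounded from below. -/
structure IsNegFamily (I : Ideal R) (a : ℤ × ℤ → R) : Prop where
  mem : ∀ p ∈ negIdx, a p ∈ I
  bounded : ∃ i₀ j₀ : ℤ, ∀ p ∈ negIdx, a p ≠ 0 → i₀ < p.1 ∧ j₀ < p.2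

theorem isNegFamily_zero (I : Ideal R) : IsNegFamily I 0 := ⟨by simp, 0, 0, by simp⟩

theorem IsNegFamily.mono (h : IsNegFamily I a) (hIJ : I ≤ J) : IsNegFamily J a :=
  ⟨fun p hp => hIJ (h.mem p hp), h.bounded⟩

theorem IsNegFamily.sub (ha : IsNegFamily I a) (hb : IsNegFamily I b) : IsNegFamily I (a - b) := by
  refine ⟨fun p hp => sub_mem (ha.mem p hp) (hb.mem p hp), ?_⟩
  obtain ⟨i₀, j₀, ha⟩ := ha.bounded
  obtain ⟨i₁, j₁, hb⟩ := hb.bounded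
  refine ⟨min i₀ i₁, min j₀ j₁, fun p hp h => ?_⟩
  by_cases hap : a p = 0
  · have := hb p hp fun hbp => h (by simp [hap, hbp])
    omega
  · have := ha p hp hap
    omega

theorem isNegFamily_biCoeff {e : DoubleLaurent R} (he : e ∈ coeffIdeal I) :
    IsNegFamily I fun p => biCoeff p e := by
  refine ⟨fun p _ => he p, ?_⟩
  obtain ⟨⟨i₀, hi₀⟩, -⟩ := isLexPWO_iff.1 (isLexPWO_support e)
  obtain ⟨j₀, hj₀⟩ := (((isLexPWO_support e).finite_inter_region 1 fun _ => 0).image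
    Prod.snd).bddBelow
  refine ⟨i₀ - 1, min j₀ 0 - 1, fun p hp h => ?_⟩
  have hp1 : p.1 < 1 := by rcases hp with h | h <;> omega
  refine ⟨Int.sub_one_lt_of_le (hi₀ ⟨p, h, rfl⟩), Int.sub_one_lt_of_le (min_le_iff.2 ?_)⟩
  exact (lt_or_ge p.2 0).imp_left fun h2 => hj₀ ⟨p, ⟨h, hp1, h2⟩, rfl⟩

theorem IsNegFamily.card_le (ha : IsNegFamily I a) (hI : I ^ N = ⊥)
    (hT : (T : Set (ℤ × ℤ)) ⊆ negIdx) (hT0 : expansionTerm a T ≠ 0) : T.card ≤ N := by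
  by_contra! hlt
  have hmem : ∏ p ∈ T, a p ∈ I ^ T.card := by
    simpa using Ideal.prod_mem_prod (I := fun _ => I) fun p hp => ha.mem p (hT hp)
  have := Ideal.pow_le_pow_right hlt.le hmem
  rw [hI, Ideal.mem_bot] at this
  exact right_ne_zero_of_mul hT0 this

/-- As `I ^ N = ⊥`, a non-zero term has at most `N` factors. -/
theorem IsNegFamily.exists_forall_neg_mul_le_sum (ha : IsNegFamily I a) (hI : I ^ N = ⊥) :
    ∃ c : ℕ, ∀ T : Finset (ℤ × ℤ), (T : Set (ℤ × ℤ)) ⊆ negIdx → expansionTerm a T ≠ 0 →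
      (∀ p ∈ T, -(c : ℤ) ≤ p.1 ∧ -(c : ℤ) ≤ p.2) ∧
        ∀ U ⊆ T, -((N : ℤ) * c) ≤ (∑ p ∈ U, p).1 ∧ -((N : ℤ) * c) ≤ (∑ p ∈ U, p).2 := by
  obtain ⟨i₀, j₀, hb⟩ := ha.bounded
  refine ⟨i₀.natAbs + j₀.natAbs, fun T hT hT0 => ?_⟩
  generalize hc : i₀.natAbs + j₀.natAbs = c
  have hmem : ∀ p ∈ T, -(c : ℤ) ≤ p.1 ∧ -(c : ℤ) ≤ p.2 := fun p hp => by
    have := hb p (hT hp) (ne_zero_of_expansionTerm_ne_zero hT0 hp)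
    omega
  refine ⟨hmem, fun U hU => ?_⟩
  have hcard : (U.card : ℤ) ≤ N :=
    mod_cast (Finset.card_le_card hU).trans (ha.card_le hI hT hT0)
  have hle : -((N : ℤ) * c) ≤ U.card • -(c : ℤ) := by
    rw [nsmul_eq_mul]
    nlinarith
  rw [Prod.fst_sum, Prod.snd_sum]
  exact ⟨hle.trans (Finset.card_nsmul_le_sum _ _ _ fun p hp => (hmem p (hU hp)).1),
    hle.trans (Finset.card_nsmul_le_sum _ _ _ fun p hp => (hmem p (hU hp)).2)⟩

theorem IsNegFamily.summableExpansion (ha : IsNegFamily I a) (hI : I ^ N = ⊥) :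
    SummableExpansion negIdx a := by
  classical
  obtain ⟨c, hc⟩ := ha.exists_forall_neg_mul_le_sum hI
  refine ⟨isLexPWO_of_bounded (i₀ := -((N : ℤ) * c)) (j₀ := -((N : ℤ) * c)) ?_, fun q => ?_⟩
  · rintro _ ⟨T, ⟨hT, rfl⟩, hT0⟩
    exact (hc T hT hT0).2 T subset_rfl
  · refine (Finset.finite_toSet (Finset.Icc (-(c : ℤ)) 0 ×ˢ
      Finset.Icc (-(c : ℤ)) (q.2 + N * c)).powerset).subset ?_
    rintro T ⟨⟨hT, rfl⟩, hT0⟩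
    refine Finset.mem_coe.2 (Finset.mem_powerset.2 fun p hp => ?_)
    have hp1 : p.1 ≤ 0 := by rcases hT hp with h | h <;> omega
    have hle := (hc T hT hT0).1 p hp
    have hrest := ((hc T hT hT0).2 _ (Finset.erase_subset p T)).2
    have hsum : (∑ p ∈ T, p).2 = p.2 + (∑ p ∈ T.erase p, p).2 := by
      rw [← Prod.snd_add, Finset.add_sum_erase T (fun p => p) hp]
    simp only [Finset.mem_product, Finset.mem_Icc]
    omega

end NegativeProducts

section PositiveProducts

variable {R : Type*} [CommRing R] {V W : Set (ℤ × ℤ)} {a : ℤ × ℤ → R} {x : DoubleLaurent R}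
  {q : ℤ × ℤ} {S : Finset (ℤ × ℤ)}

theorem mem_posIdx_of_mem_closure (hV : V ⊆ posIdx) (hq : q ∈ AddSubmonoid.closure V)
    (hq0 : q ≠ 0) : q ∈ posIdx := by
  have hnonneg : 0 ≤ toLex q := by
    clear hq0
    induction hq using AddSubmonoid.closure_induction with
    | mem q hq => exact (mem_posIdx_iff.1 (hV hq)).le
    | zero => exact le_rfl
    | add p q _ _ hp hq => exact add_nonneg hp hq
  exact mem_posIdx_iff.2 (lt_of_le_of_ne hnonneg fun h => hq0 (congrArg ofLex h).symm)

theorem IsLexPWO.closure (hV : IsLexPWO V) (hpos : V ⊆ posIdx) :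
    IsLexPWO (AddSubmonoid.closure V : Set (ℤ × ℤ)) := by
  have h0 : ∀ q ∈ (ofLex ⁻¹' V : Set (ℤ ×ₗ ℤ)), 0 ≤ q := fun q hq =>
    (mem_posIdx_iff.1 (hpos hq)).le
  refine (Set.IsPWO.addSubmonoid_closure h0 hV).mono fun q hq => ?_
  have hq' : ofLex q ∈ AddSubmonoid.closure V := hq
  exact AddSubmonoid.closure_induction
    (motive := fun p _ => toLex p ∈ AddSubmonoid.closure (ofLex ⁻¹' V : Set (ℤ ×ₗ ℤ)))
    (fun _ hp => AddSubmonoid.subset_closure hp) (zero_mem _) (fun _ _ _ _ => add_mem) hq'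

theorem sum_mem_closure (hS : (S : Set (ℤ × ℤ)) ⊆ V) : ∑ p ∈ S, p ∈ AddSubmonoid.closure V :=
  sum_mem fun _ hp => AddSubmonoid.subset_closure (hS hp)

theorem finite_subsetsWithSum (hW : IsLexPWO W) (hpos : W ⊆ posIdx) (q : ℤ × ℤ) :
    (subsetsWithSum W q).Finite := by
  classical
  have hC := hW.closure hpos
  refine (hC.finite_addAntidiagonal hC q).toFinset.powerset.finite_toSet.subset ?_
  rintro T ⟨hT, rfl⟩
  refine Finset.mem_coe.2 (Finset.mem_powerset.2 fun p hp => ?_)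
  refine (Set.Finite.mem_toFinset _).2 ⟨AddSubmonoid.subset_closure (hT hp), ?_⟩
  rw [← Finset.add_sum_erase T (fun p => p) hp, add_sub_cancel_left]
  exact sum_mem_closure ((Finset.coe_subset.2 (Finset.erase_subset p T)).trans hT)

theorem subsetsWithSum_zero (hpos : W ⊆ posIdx) : subsetsWithSum W 0 = {∅} := by
  refine Set.eq_singleton_iff_unique_mem.2 ⟨by simp [subsetsWithSum], fun T hT => ?_⟩
  by_contra hne
  refine zero_notMem_posIdx ?_
  rw [← hT.2]
  exact sum_mem_posIdx (Finset.nonempty_iff_ne_empty.2 hne) fun p hp => hpos (hT.1 hp)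

theorem summableExpansion_posIdx (h : IsLexPWO {p ∈ posIdx | a p ≠ 0}) :
    SummableExpansion posIdx a := by
  have hpos : {p ∈ posIdx | a p ≠ 0} ⊆ posIdx := fun p hp => hp.1
  have hsub : ∀ q, ∀ T ∈ subsetsWithSum posIdx q, expansionTerm a T ≠ 0 →
      T ∈ subsetsWithSum {p ∈ posIdx | a p ≠ 0} q := fun q T hT hT0 =>
    ⟨fun p hp => ⟨hT.1 hp, ne_zero_of_expansionTerm_ne_zero hT0 hp⟩, hT.2⟩
  refine ⟨(h.closure hpos).mono ?_, fun q => (finite_subsetsWithSum h hpos q).subset ?_⟩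
  · rintro q ⟨T, hT, hT0⟩
    exact (hsub q T hT hT0).2 ▸ sum_mem_closure (hsub q T hT hT0).1
  · exact fun T hT => hsub q T hT.1 hT.2

theorem singleton_mem_subsetsWithSum (hq : q ∈ W) : {q} ∈ subsetsWithSum W q :=
  ⟨by simpa using hq, Finset.sum_singleton _ _⟩

theorem expansionCoeff_eq_neg_add (hfin : (subsetsWithSum W q).Finite) (hq : q ∈ W) :
    expansionCoeff W a q =
      -a q + ∑ᶠ T ∈ subsetsWithSum W q \ {{q}}, expansionTerm a T := by
  have hsub : ({{q}} : Set (Finset (ℤ × ℤ))) ⊆ subsetsWithSum W q :=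
    Set.singleton_subset_iff.2 (singleton_mem_subsetsWithSum hq)
  rw [expansionCoeff, ← finsum_mem_add_sdiff hsub hfin, finsum_mem_singleton]
  simp [expansionTerm]

/-- The system is triangular: `a q` enters the coefficient at `q` as `-a q`, and the other terms
only involve `a p` with `p < q`. -/
theorem exists_expansionCoeff_eq (hW : IsLexPWO W) (hpos : W ⊆ posIdx) (c : ℤ × ℤ → R) :
    ∃ a : ℤ × ℤ → R, (∀ q ∉ W, a q = 0) ∧ ∀ q ∈ W, expansionCoeff W a q = c q := by
  classical
  have hwf : WellFounded fun p q : ℤ × ℤ => toLex p < toLex q ∧ p ∈ W ∧ q ∈ W :=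
    InvImage.wf toLex (Set.wellFoundedOn_iff.1 hW.isWF)
  let step (q : ℤ × ℤ) (a : ∀ p, (toLex p < toLex q ∧ p ∈ W ∧ q ∈ W) → R) : R :=
    if q ∈ W then -c q + ∑ᶠ T ∈ subsetsWithSum W q \ {{q}},
      expansionTerm (fun p => if h : _ then a p h else 0) T else 0
  have hfix : ∀ q, hwf.fix step q = if q ∈ W then
      -c q + ∑ᶠ T ∈ subsetsWithSum W q \ {{q}}, expansionTerm (hwf.fix step) T else 0 := by
    refine fun q => (hwf.fix_eq step q).trans (if_ctx_congr Iff.rfl (fun hq => ?_) fun _ => rfl)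
    congr 1
    refine finsum_mem_congr rfl fun T hT => congrArg _ (Finset.prod_congr rfl fun p hp => ?_)
    obtain ⟨⟨hTW, rfl⟩, hTq⟩ := hT
    refine dif_pos ⟨toLex_lt_toLex_iff.2 ?_, hTW hp, hq⟩
    refine sum_sub_mem_posIdx (fun p hp => hpos (hTW hp)) hp ?_
    rintro rfl
    simp at hTq
  refine ⟨hwf.fix step, fun q hq => by rw [hfix, if_neg hq], fun q hq => ?_⟩
  rw [expansionCoeff_eq_neg_add (finite_subsetsWithSum hW hpos q) hq, hfix q, if_pos hq]
  ring

theorem exists_hasInfiniteProduct_posIdx (hx : x ∈ nonnegSubring R) (h0 : biCoeff 0 x = 1) :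
    ∃ a, HasInfiniteProduct posIdx a x := by
  set V : Set (ℤ × ℤ) := {q ∈ posIdx | biCoeff q x ≠ 0}
  set W : Set (ℤ × ℤ) := (AddSubmonoid.closure V : Set (ℤ × ℤ)) \ {0}
  have hVpos : V ⊆ posIdx := fun q hq => hq.1
  have hWpos : W ⊆ posIdx := fun q hq => mem_posIdx_of_mem_closure hVpos hq.1 hq.2
  have hW : IsLexPWO W := ((isLexPWO_support x).mono fun q hq => hq.2).closure hVpos |>.mono
    Set.sdiff_subset
  obtain ⟨a, haW, ha⟩ := exists_expansionCoeff_eq hW hWpos fun q => biCoeff q x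
  have hsupp : ∀ {p}, a p ≠ 0 → p ∈ W := fun hp => by_contra fun h => hp (haW _ h)
  refine ⟨a, (summableExpansion_posIdx (hW.mono fun p hp => hsupp hp.2)).hasInfiniteProduct
    fun q => ?_⟩
  rw [← expansionCoeff_eq_of_subset hWpos fun T _ hT0 p hp =>
    hsupp (ne_zero_of_expansionTerm_ne_zero hT0 hp)]
  by_cases hqW : q ∈ W
  · exact (ha q hqW).symm
  by_cases hq0 : q = 0
  · rw [hq0, h0, expansionCoeff, subsetsWithSum_zero hWpos, finsum_mem_singleton]
    simp [expansionTerm]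
  have hqV : q ∉ AddSubmonoid.closure V := fun h => hqW ⟨h, hq0⟩
  have hempty : subsetsWithSum W q = ∅ := Set.eq_empty_of_forall_notMem fun T ⟨hT, hTq⟩ =>
    hqV <| hTq ▸ sum_mem fun p hp => (hT hp).1
  rw [expansionCoeff, hempty, finsum_mem_empty]
  by_contra hne
  rcases mem_negIdx_or_eq_zero_or_mem_posIdx q with hq | hq | hq
  exacts [hne (hx q hq), hq0 hq, hqV (AddSubmonoid.subset_closure ⟨hq, hne⟩)]

theorem partialProd_mem_nonnegSubring (hS : (S : Set (ℤ × ℤ)) ⊆ posIdx) :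
    partialProd a S ∈ nonnegSubring R :=
  prod_mem fun _ hp => sub_mem (one_mem _) <|
    mono_mem_nonnegSubring (notMem_negIdx_of_mem_posIdx (hS hp)) _

theorem biCoeff_zero_partialProd (hS : (S : Set (ℤ × ℤ)) ⊆ posIdx) :
    biCoeff 0 (partialProd a S) = 1 := by
  rw [biCoeff_partialProd, expansionCoeff, subsetsWithSum_zero hS, finsum_mem_singleton]
  simp [expansionTerm]

theorem HasInfiniteProduct.mem_nonnegSubring (h : HasInfiniteProduct posIdx a x) :
    x ∈ nonnegSubring R := fun q hq => by
  obtain ⟨S, hS, h⟩ := h.exists_biCoeff_eq q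
  rw [h S subset_rfl hS, partialProd_mem_nonnegSubring hS q hq]

theorem HasInfiniteProduct.biCoeff_zero (h : HasInfiniteProduct posIdx a x) :
    biCoeff 0 x = 1 := by
  obtain ⟨S, hS, h⟩ := h.exists_biCoeff_eq 0
  rw [h S subset_rfl hS, biCoeff_zero_partialProd hS]

theorem HasInfiniteProduct.finite_support_inter_region (h : HasInfiniteProduct posIdx a x) (m : ℤ)
    (n : ℤ → ℤ) : {p | p ∈ posIdx ∧ a p ≠ 0 ∧ p.1 < m ∧ p.2 < n p.1}.Finite := by
  classical
  obtain ⟨S, hS, h⟩ := h m n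
  refine S.finite_toSet.subset ?_
  rintro p ⟨hp, hap, hpm, hpn⟩
  by_contra hpS
  refine hap ?_
  have h1 := h S subset_rfl hS p.1 hpm p.2 hpn
  have h2 := h (insert p S) (Finset.subset_insert p S) (by
    rw [Finset.coe_insert]
    exact Set.insert_subset hp hS) p.1 hpm p.2 hpn
  rw [← biCoeff_apply, map_sub, sub_eq_zero] at h1 h2
  rw [Finset.prod_insert hpS, sub_mul, one_mul, map_sub, h1, biCoeff_mono_mul,
    show p - (p.1, p.2) = 0 from sub_self p, ← partialProd, biCoeff_zero_partialProd hS] at h2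
  simpa using h2

theorem HasInfiniteProduct.isLexPWO_support (h : HasInfiniteProduct posIdx a x) :
    IsLexPWO {p ∈ posIdx | a p ≠ 0} := by
  refine isLexPWO_iff.2 ⟨⟨0, ?_⟩, fun i => ?_⟩
  · rintro _ ⟨p, ⟨hp | hp, -⟩, rfl⟩
    exacts [hp.le, hp.1.ge]
  · obtain ⟨j₀, hj₀⟩ := ((h.finite_support_inter_region (i + 1) fun _ => 0).image
      Prod.snd).bddBelow
    refine ⟨min j₀ 0, fun j hj => min_le_iff.2 ?_⟩
    exact (lt_or_ge j 0).imp_left fun hj0 => hj₀ ⟨(i, j), ⟨hj.1, hj.2, by simp, hj0⟩, rfl⟩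

end PositiveProducts

section Congruences

variable {R : Type*} [CommRing R] {I : Ideal R} {s : Set (ℤ × ℤ)} {a b : ℤ × ℤ → R}
  {x y : DoubleLaurent R} {n : ℕ} {S : Finset (ℤ × ℤ)}

theorem partialProd_cons {p : ℤ × ℤ} (hp : p ∉ S) :
    partialProd a (S.cons p hp) = (1 - mono p.1 p.2 (a p)) * partialProd a S :=
  Finset.prod_cons hp

theorem partialProd_sub_one_mem (ha : ∀ p ∈ S, a p ∈ I) : partialProd a S - 1 ∈ coeffIdeal I := by
  induction S using Finset.cons_induction with
  | empty => simp [partialProd]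
  | cons p S hp ih =>
    have hS := ih fun q hq => ha q (Finset.mem_cons_of_mem hq)
    have hap := mono_mem_coeffIdeal (ha p (Finset.mem_cons_self p S)) p.1 p.2
    have heq : partialProd a (S.cons p hp) - 1 =
        (partialProd a S - 1) - partialProd a S * mono p.1 p.2 (a p) := by
      rw [partialProd_cons]
      ring
    exact heq ▸ sub_mem hS (Ideal.mul_mem_left _ _ hap)

theorem partialProd_sub_sub_sum_mem (hn : n ≠ 0) (ha : ∀ p ∈ S, a p ∈ I)
    (hb : ∀ p ∈ S, b p ∈ I ^ n) :
    partialProd (a - b) S - partialProd a S - ∑ p ∈ S, mono p.1 p.2 (b p) ∈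
      coeffIdeal (I ^ (n + 1)) := by
  induction S using Finset.cons_induction with
  | empty => simp [partialProd]
  | cons p S hp ih =>
    rw [Finset.forall_mem_cons] at ha hb
    have hsub : partialProd (a - b) S - 1 ∈ coeffIdeal I := partialProd_sub_one_mem fun q hq =>
      sub_mem (ha.2 q hq) (Ideal.pow_le_self hn (hb.2 q hq))
    have hsum : ∑ q ∈ S, mono q.1 q.2 (b q) ∈ coeffIdeal (I ^ n) :=
      sum_mem fun q hq => mono_mem_coeffIdeal (hb.2 q hq) q.1 q.2
    have hap := mono_mem_coeffIdeal ha.1 p.1 p.2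
    have hbp := mono_mem_coeffIdeal hb.1 p.1 p.2
    have heq : partialProd (a - b) (S.cons p hp) - partialProd a (S.cons p hp) -
        ∑ q ∈ S.cons p hp, mono q.1 q.2 (b q) =
        (1 - mono p.1 p.2 (a p)) * (partialProd (a - b) S - partialProd a S -
          ∑ q ∈ S, mono q.1 q.2 (b q)) - mono p.1 p.2 (a p) * ∑ q ∈ S, mono q.1 q.2 (b q) +
          mono p.1 p.2 (b p) * (partialProd (a - b) S - 1) := by
      rw [partialProd_cons, partialProd_cons, Finset.sum_cons, Pi.sub_apply, mono_sub]
      ring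
    rw [heq]
    exact add_mem (sub_mem (Ideal.mul_mem_left _ _ (ih ha.2 hb.2))
      (mul_mem_coeffIdeal (pow_succ' I n).ge hap hsum))
      (mul_mem_coeffIdeal (pow_succ I n).ge hbp hsub)

theorem HasInfiniteProduct.sub_one_mem (h : HasInfiniteProduct s a x) (ha : ∀ p ∈ s, a p ∈ I) :
    x - 1 ∈ coeffIdeal I := fun q => by
  obtain ⟨S, hS, h⟩ := h.exists_biCoeff_eq q
  rw [map_sub, h S subset_rfl hS, ← map_sub]
  exact partialProd_sub_one_mem (fun p hp => ha p (hS hp)) q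

theorem HasInfiniteProduct.biCoeff_sub_sub_mem (hn : n ≠ 0) (ha : ∀ p ∈ s, a p ∈ I)
    (hb : ∀ p ∈ s, b p ∈ I ^ n) (hx : HasInfiniteProduct s a x)
    (hy : HasInfiniteProduct s (a - b) y) (q : ℤ × ℤ) :
    biCoeff q y - biCoeff q x - s.indicator b q ∈ I ^ (n + 1) := by
  classical
  obtain ⟨S₁, hS₁, h₁⟩ := hx.exists_biCoeff_eq q
  obtain ⟨S₂, hS₂, h₂⟩ := hy.exists_biCoeff_eq q
  obtain ⟨S, hS, hS₁S, hS₂S, hqS⟩ : ∃ S : Finset (ℤ × ℤ), (S : Set (ℤ × ℤ)) ⊆ s ∧ S₁ ⊆ S ∧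
      S₂ ⊆ S ∧ (q ∈ s → q ∈ S) := by
    refine ⟨S₁ ∪ S₂ ∪ ({q} : Finset (ℤ × ℤ)).filter (· ∈ s), fun p hp => ?_, fun p hp => ?_,
      fun p hp => ?_, fun hq => ?_⟩
    · simp only [Finset.coe_union, Finset.coe_filter] at hp
      exact hp.elim (fun hp => hp.elim (@hS₁ p) (@hS₂ p)) And.right
    all_goals simp_all
  have hsum : biCoeff q (∑ p ∈ S, mono p.1 p.2 (b p)) = s.indicator b q := by
    simp only [map_sum, biCoeff_mono, Prod.mk.eta, Finset.sum_ite_eq, Set.indicator_apply]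
    exact if_congr ⟨@hS q, hqS⟩ rfl rfl
  rw [h₁ S hS₁S hS, h₂ S hS₂S hS, ← hsum, ← map_sub, ← map_sub]
  exact partialProd_sub_sub_sum_mem hn (fun p hp => ha p (hS hp)) (fun p hp => hb p (hS hp)) q

theorem HasInfiniteProduct.biCoeff_sub_one_add_mem_sq (ha : ∀ p ∈ s, a p ∈ I)
    (hx : HasInfiniteProduct s a x) (q : ℤ × ℤ) :
    biCoeff q (x - 1) + s.indicator a q ∈ I ^ 2 := by
  have hx' : HasInfiniteProduct s (0 - -a) x := by rwa [zero_sub, neg_neg]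
  have := hasInfiniteProduct_zero.biCoeff_sub_sub_mem one_ne_zero (fun _ _ => I.zero_mem)
    (fun p hp => by simpa using ha p hp) hx' q
  rwa [Set.indicator_neg', Pi.neg_apply, sub_neg_eq_add, ← map_sub] at this

/-- At a minimal `q` with `a q ∉ I`, all terms of the expansion of the coefficient at `q` except
`-a q` lie in `I`. -/
theorem HasInfiniteProduct.coeff_mem_of_sub_one_mem (h : HasInfiniteProduct posIdx a x)
    (hx : x - 1 ∈ coeffIdeal I) : ∀ q ∈ posIdx, a q ∈ I := by
  classical
  by_contra! hne
  have hpwo : IsLexPWO {q ∈ posIdx | a q ∉ I} := h.isLexPWO_support.mono fun q hq =>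
    ⟨hq.1, fun h0 => hq.2 (h0 ▸ I.zero_mem)⟩
  obtain ⟨q, ⟨hq, hqI⟩, hmin⟩ := hpwo.exists_minimal hne
  obtain ⟨S, hS, hS'⟩ := h.exists_biCoeff_eq q
  have hqS : ((insert q S : Finset (ℤ × ℤ)) : Set (ℤ × ℤ)) ⊆ posIdx := by
    rw [Finset.coe_insert]
    exact Set.insert_subset hq hS
  have hfin : (subsetsWithSum ((insert q S : Finset (ℤ × ℤ)) : Set (ℤ × ℤ)) q).Finite :=
    finite_subsetsWithSum (isLexPWO_of_finite (Finset.finite_toSet _)) hqS q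
  have hxq := hx q
  rw [map_sub, biCoeff_one, if_neg (ne_of_mem_of_not_mem hq zero_notMem_posIdx), sub_zero,
    hS' _ (Finset.subset_insert q S) hqS, biCoeff_partialProd,
    expansionCoeff_eq_neg_add hfin (Finset.mem_insert_self q S)] at hxq
  refine hqI (neg_mem_iff.1 ((I.add_mem_iff_left ?_).1 hxq))
  refine finsum_mem_induction (· ∈ I) I.zero_mem (fun _ _ => I.add_mem) ?_
  rintro T ⟨⟨hTS, rfl⟩, hTq⟩
  obtain ⟨p, hp⟩ : T.Nonempty := Finset.nonempty_iff_ne_empty.2 fun h0 =>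
    zero_notMem_posIdx (by simpa [h0] using hq)
  have hTpos : ∀ p ∈ T, p ∈ posIdx := fun p hp => hqS (hTS hp)
  have hTp : T ≠ {p} := by
    rintro rfl
    simp at hTq
  have hpI : a p ∈ I := by_contra fun hpI =>
    hmin p ⟨hTpos p hp, hpI⟩ (sum_sub_mem_posIdx hTpos hp hTp)
  rw [expansionTerm, ← Finset.mul_prod_erase _ _ hp]
  exact I.mul_mem_left _ (I.mul_mem_right _ hpI)

end Congruences

namespace Decomposition

variable {R : Type*} [CommRing R] {I : Ideal R} {y : DoubleLaurent R} (F : Decomposition y)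

theorem eq_neg_mul_mul_pos : y = F.neg * (mono F.ν.1 F.ν.2 (F.unit : R) * F.pos) := by
  rw [← mul_assoc]
  exact F.eq_mul

theorem isNegFamily (hI : nilradical R ≤ I) : IsNegFamily I F.a :=
  ⟨fun p hp => hI (F.a_nilpotent p hp), F.a_bounded⟩

variable {F}

theorem unit_mul_biCoeff_sub_mem (hI : nilradical R ≤ I) (hy : y - 1 ∈ coeffIdeal I) (q : ℤ × ℤ) :
    (F.unit : R) * biCoeff (q - F.ν) F.pos - biCoeff q (1 : DoubleLaurent R) ∈ I := by
  have hneg := F.neg_eq.sub_one_mem (F.isNegFamily hI).mem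
  have heq : mono F.ν.1 F.ν.2 (F.unit : R) * F.pos - 1 =
      (y - 1) - mono F.ν.1 F.ν.2 (F.unit : R) * F.pos * (F.neg - 1) := by
    linear_combination -F.eq_neg_mul_mul_pos
  have := (heq ▸ sub_mem hy (Ideal.mul_mem_left _ _ hneg) :
    mono F.ν.1 F.ν.2 (F.unit : R) * F.pos - 1 ∈ coeffIdeal I) q
  rwa [map_sub, biCoeff_mono_mul] at this

theorem ν_eq_zero_of_sub_one_mem (hI : nilradical R ≤ I) (hI' : I ≠ ⊤)
    (hy : y - 1 ∈ coeffIdeal I) : F.ν = 0 := by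
  by_contra hν
  have := unit_mul_biCoeff_sub_mem (F := F) hI hy F.ν
  rw [sub_self, F.pos_eq.biCoeff_zero, biCoeff_one, if_neg hν, sub_zero, mul_one] at this
  exact hI' (Ideal.eq_top_of_isUnit_mem _ this F.unit.isUnit)

theorem unit_sub_one_mem (hI : nilradical R ≤ I) (hν : F.ν = 0) (hy : y - 1 ∈ coeffIdeal I) :
    (F.unit : R) - 1 ∈ I := by
  have := unit_mul_biCoeff_sub_mem (F := F) hI hy 0
  rwa [hν, sub_zero, F.pos_eq.biCoeff_zero, biCoeff_one, if_pos rfl, mul_one] at this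

theorem pos_sub_one_mem (hI : nilradical R ≤ I) (hν : F.ν = 0) (hy : y - 1 ∈ coeffIdeal I) :
    F.pos - 1 ∈ coeffIdeal I := fun q => by
  have hpos := unit_mul_biCoeff_sub_mem (F := F) hI hy q
  have hunit := I.mul_mem_right (biCoeff q (1 : DoubleLaurent R)) (unit_sub_one_mem hI hν hy)
  rw [hν, sub_zero] at hpos
  rw [← Ideal.unit_mul_mem_iff_mem I F.unit.isUnit, map_sub]
  convert sub_mem hpos hunit using 1
  ring

theorem a_mem_of_sub_one_mem (hI : nilradical R ≤ I) (hν : F.ν = 0) (hy : y - 1 ∈ coeffIdeal I)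
    (p : ℤ × ℤ) : F.a p ∈ I := by
  rcases mem_negIdx_or_eq_zero_or_mem_posIdx p with hp | rfl | hp
  · exact (F.isNegFamily hI).mem p hp
  · exact F.a_zero.symm ▸ I.zero_mem
  · exact F.pos_eq.coeff_mem_of_sub_one_mem (pos_sub_one_mem hI hν hy) p hp

theorem biCoeff_add_a_mem_sq (hI : nilradical R ≤ I) (hν : F.ν = 0) (hy : y - 1 ∈ coeffIdeal I)
    {p : ℤ × ℤ} (hp : p ≠ 0) : biCoeff p y + F.a p ∈ I ^ 2 := by
  have ha := a_mem_of_sub_one_mem hI hν hy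
  have hneg := F.neg_eq.sub_one_mem fun p _ => ha p
  have hpos := F.pos_eq.sub_one_mem fun p _ => ha p
  have hunit : mono 0 0 ((F.unit : R) - 1) ∈ coeffIdeal I :=
    mono_mem_coeffIdeal (unit_sub_one_mem hI hν hy) 0 0
  have hyeq := F.eq_neg_mul_mul_pos
  rw [hν] at hyeq
  have heq : y - (F.neg - 1) - (F.pos - 1) - mono 0 0 (F.unit : R) =
      F.pos * ((F.neg - 1) * mono 0 0 ((F.unit : R) - 1)) + (F.neg - 1) * (F.pos - 1) +
        mono 0 0 ((F.unit : R) - 1) * (F.pos - 1) := by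
    have hmono : mono 0 0 ((F.unit : R) - 1) = mono 0 0 (F.unit : R) - 1 := mono_sub 0 0 _ _
    rw [hmono]
    linear_combination hyeq
  have hle : I * I ≤ I ^ 2 := (sq I).ge
  have hmem : y - (F.neg - 1) - (F.pos - 1) - mono 0 0 (F.unit : R) ∈ coeffIdeal (I ^ 2) :=
    heq ▸ add_mem (add_mem (Ideal.mul_mem_left _ _ (mul_mem_coeffIdeal hle hneg hunit))
      (mul_mem_coeffIdeal hle hneg hpos)) (mul_mem_coeffIdeal hle hunit hpos)
  have hsum : negIdx.indicator F.a p + posIdx.indicator F.a p = F.a p := by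
    rcases mem_negIdx_or_eq_zero_or_mem_posIdx p with h | h | h
    · rw [Set.indicator_of_mem h,
        Set.indicator_of_notMem fun h' => notMem_negIdx_of_mem_posIdx h' h, add_zero]
    · exact absurd h hp
    · rw [Set.indicator_of_mem h, Set.indicator_of_notMem (notMem_negIdx_of_mem_posIdx h),
        zero_add]
  have hadd := add_mem (hmem p) <| add_mem
    (F.neg_eq.biCoeff_sub_one_add_mem_sq (fun p _ => ha p) p)
    (F.pos_eq.biCoeff_sub_one_add_mem_sq (fun p _ => ha p) p)
  rw [map_sub, map_sub, map_sub, biCoeff_mono, if_neg (show p ≠ (0, 0) from hp), sub_zero] at hadd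
  convert hadd using 1
  linear_combination -hsum

end Decomposition

section Existence

variable {R : Type*} [CommRing R] {I : Ideal R} {N n : ℕ} {f x y w w₀ : DoubleLaurent R}
  {a : ℤ × ℤ → R}

theorem isUnit_of_isUnit_coeff_zero {A : Type*} [CommRing A] {x : LaurentSeries A}
    (hneg : ∀ i < 0, x.coeff i = 0) (h0 : IsUnit (x.coeff 0)) : IsUnit x := by
  nontriviality A
  have hne : x.coeff 0 ≠ 0 := h0.ne_zero
  have hx : x ≠ 0 := by
    rintro rfl
    exact hne HahnSeries.coeff_zero
  have hord : x.order = 0 := le_antisymm (HahnSeries.order_le_of_coeff_ne_zero hne)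
    ((HahnSeries.le_order_iff_forall hx).2 fun i hi => hneg i hi)
  refine HahnSeries.isUnit_of_isUnit_leadingCoeff_AddUnitOrder ?_ (AddGroup.isAddUnit _)
  rwa [HahnSeries.leadingCoeff_eq, hord]

theorem isUnit_of_isUnit_biCoeff_zero (hw : w ∈ nonnegSubring R) (h0 : IsUnit (biCoeff 0 w)) :
    IsUnit w := by
  refine isUnit_of_isUnit_coeff_zero (fun i hi => HahnSeries.ext (funext fun j => ?_))
    (isUnit_of_isUnit_coeff_zero (fun j hj => ?_) h0)
  · exact hw (i, j) (Or.inl hi)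
  · exact hw (0, j) (Or.inr ⟨rfl, hj⟩)

theorem restrict_mem_coeffIdeal {s : Set (ℤ × ℤ)} (hx : ∀ q ∈ s, biCoeff q x ∈ I) :
    restrict s x ∈ coeffIdeal I := fun q => by
  classical
  rw [biCoeff_restrict, Set.indicator_apply]
  split_ifs with hq
  exacts [hx q hq, I.zero_mem]

theorem sub_restrict_negIdx_mem_nonnegSubring (x : DoubleLaurent R) :
    x - restrict negIdx x ∈ nonnegSubring R := fun q hq => by
  rw [map_sub, biCoeff_restrict, Set.indicator_of_mem hq, sub_self]

/-- An approximation, up to a power of `I`, of a factorization of `y` into a product over the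
negative indices and a series without negative terms that is congruent to `w₀` modulo `I`. -/
structure ApproxFactorization (I : Ideal R) (y w₀ : DoubleLaurent R) (n : ℕ) where
  a : ℤ × ℤ → R
  neg : DoubleLaurent R
  nonneg : DoubleLaurent R
  isNegFamily : IsNegFamily I a
  hasInfiniteProduct : HasInfiniteProduct negIdx a neg
  nonneg_mem : nonneg ∈ nonnegSubring R
  nonneg_sub_mem : nonneg - w₀ ∈ coeffIdeal I
  sub_mul_mem : y - neg * nonneg ∈ coeffIdeal (I ^ (n + 1))

/-- One step of successive approximation: write the relative error `(y - neg * nonneg) / w₀` as the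
sum of its negative terms `e₁` and the other terms `e₂`, and change the two factors by `1 + e₁` and
`1 + e₂`. -/
theorem ApproxFactorization.exists_succ (A : ApproxFactorization I y w₀ n) (hI : I ^ N = ⊥)
    (hw₀ : w₀ ∈ nonnegSubring R) (hunit : IsUnit w₀) :
    Nonempty (ApproxFactorization I y w₀ (n + 1)) := by
  obtain ⟨v, hv⟩ := hunit.exists_left_inv
  obtain ⟨a, x, w, ha, hx, hw, hww₀, he⟩ := A
  have hle : I ^ (n + 1) ≤ I := Ideal.pow_le_self n.succ_ne_zero
  set e := v * (y - x * w)
  set e₁ := restrict negIdx e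
  have hemem : e ∈ coeffIdeal (I ^ (n + 1)) := Ideal.mul_mem_left _ _ he
  have he₁ : e₁ ∈ coeffIdeal (I ^ (n + 1)) := restrict_mem_coeffIdeal fun q _ => hemem q
  have he₂ : e - e₁ ∈ coeffIdeal (I ^ (n + 1)) := sub_mem hemem he₁
  have ha' := ha.sub ((isNegFamily_biCoeff hemem).mono hle)
  obtain ⟨x', hx'⟩ := (ha'.summableExpansion hI).exists_hasInfiniteProduct
  have hxx' : x' - x - e₁ ∈ coeffIdeal (I ^ (n + 2)) := fun q => by
    rw [map_sub, map_sub, biCoeff_restrict]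
    exact hx.biCoeff_sub_sub_mem n.succ_ne_zero ha.mem (fun p _ => hemem p) hx' q
  have hx'1 := hx'.sub_one_mem ha'.mem
  refine ⟨⟨_, x', w + (e - e₁) * w₀, ha', hx', ?_, ?_, ?_⟩⟩
  · exact add_mem hw (mul_mem (sub_restrict_negIdx_mem_nonnegSubring e) hw₀)
  · rw [add_sub_right_comm]
    exact add_mem hww₀ (Ideal.mul_mem_right _ _ (coeffIdeal_mono hle he₂))
  · have heq : y - x' * (w + (e - e₁) * w₀) =
        -((x' - x - e₁) * w) - e₁ * (w - w₀) - (x' - 1) * (e - e₁) * w₀ := by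
      linear_combination -(y - x * w) * hv
    rw [heq]
    exact sub_mem (sub_mem (neg_mem (Ideal.mul_mem_right _ _ hxx'))
      (mul_mem_coeffIdeal (pow_succ I (n + 1)).ge he₁ hww₀))
      (Ideal.mul_mem_right _ _ (mul_mem_coeffIdeal (pow_succ' I (n + 1)).ge hx'1 he₂))

theorem nonempty_approxFactorization (hI : I ^ N = ⊥) (hw₀ : w₀ ∈ nonnegSubring R)
    (hunit : IsUnit w₀) (hy : y - w₀ ∈ coeffIdeal I) (n : ℕ) :
    Nonempty (ApproxFactorization I y w₀ n) := by
  induction n with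
  | zero =>
    exact ⟨⟨0, 1, w₀, isNegFamily_zero I, hasInfiniteProduct_zero, hw₀, by simp, by simpa using hy⟩⟩
  | succ n ih => exact ih.elim fun A => A.exists_succ hI hw₀ hunit

namespace Decomposition

theorem nonempty_of_eq_mul (ν : ℤ × ℤ) (ha : IsNegFamily (nilradical R) a)
    (hx : HasInfiniteProduct negIdx a x) (hw : w ∈ nonnegSubring R) (h0 : IsUnit (biCoeff 0 w))
    (hf : f = x * mono ν.1 ν.2 1 * w) : Nonempty (Decomposition f) := by
  classical
  obtain ⟨c, hc⟩ := h0
  have hcoeff : ∀ q, biCoeff q (mono 0 0 (c⁻¹ : Rˣ).val * w) = (c⁻¹ : Rˣ).val * biCoeff q w :=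
    fun q => by rw [biCoeff_mono_mul, show q - (0, 0) = q from sub_zero q]
  obtain ⟨b, hb⟩ := exists_hasInfiniteProduct_posIdx
    (x := mono 0 0 (c⁻¹ : Rˣ).val * w) (fun q hq => by rw [hcoeff, hw q hq, mul_zero])
    (by rw [hcoeff, ← hc, Units.inv_mul])
  obtain ⟨i₀, j₀, hbd⟩ := ha.bounded
  have hneg : ∀ p ∈ negIdx, a p = negIdx.piecewise a (posIdx.indicator b) p := fun p hp =>
    (Set.piecewise_eq_of_mem _ _ _ hp).symm
  exact ⟨{
    ν₁ := ν.1
    ν₂ := ν.2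
    unit := c
    a := negIdx.piecewise a (posIdx.indicator b)
    neg := x
    pos := mono 0 0 (c⁻¹ : Rˣ).val * w
    a_zero := (Set.piecewise_eq_of_notMem _ _ _ zero_notMem_negIdx).trans
      (Set.indicator_of_notMem zero_notMem_posIdx b)
    a_nilpotent := fun p hp => hneg p hp ▸ ha.mem p hp
    a_bounded := ⟨i₀, j₀, fun p hp h => hbd p hp (hneg p hp ▸ h)⟩
    neg_eq := hx.congr hneg
    pos_eq := hb.congr fun p hp => by
      rw [Set.piecewise_eq_of_notMem _ _ _ (notMem_negIdx_of_mem_posIdx hp),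
        Set.indicator_of_mem hp]
    eq_mul := by
      rw [hf, mul_assoc, mul_assoc, ← mul_assoc (mono _ _ (c : R)), mono_mul_mono, Units.mul_inv,
        add_zero, add_zero] }⟩

theorem nonempty_of_isUnit_biCoeff (hI : I ^ N = ⊥) (ν : ℤ × ℤ) (hν : IsUnit (biCoeff ν f))
    (hneg : ∀ q ∈ negIdx, biCoeff (ν + q) f ∈ I) : Nonempty (Decomposition f) := by
  set y := mono (-ν.1) (-ν.2) 1 * f with hy
  have hcoeff : ∀ q, biCoeff q y = biCoeff (ν + q) f := fun q => by
    rw [biCoeff_mono_mul, one_mul, show q - (-ν.1, -ν.2) = ν + q by ext <;> simp [add_comm]]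
  have hnil : I ≤ nilradical R := fun r hr => ⟨N, by simpa [hI] using Ideal.pow_mem_pow hr N⟩
  have hw₀ := sub_restrict_negIdx_mem_nonnegSubring y
  have h0 : biCoeff 0 (y - restrict negIdx y) = biCoeff ν f := by
    rw [map_sub, biCoeff_restrict, Set.indicator_of_notMem zero_notMem_negIdx, sub_zero, hcoeff,
      add_zero]
  have hyw₀ : y - (y - restrict negIdx y) ∈ coeffIdeal I := by
    rw [sub_sub_cancel]
    exact restrict_mem_coeffIdeal fun q hq => (hcoeff q).symm ▸ hneg q hq
  obtain ⟨a, x, w, ha, hx, hw, hww₀, he⟩ := (nonempty_approxFactorization hI hw₀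
    (isUnit_of_isUnit_biCoeff_zero hw₀ (h0.symm ▸ hν)) hyw₀ N).some
  have hyxw : y = x * w := sub_eq_zero.1 <| ext_biCoeff fun q => by
    simpa [hI] using Ideal.pow_le_pow_right N.le_succ (he q)
  refine nonempty_of_eq_mul ν (ha.mono hnil) hx hw ?_ ?_
  · have := IsNilpotent.isUnit_add_right_of_commute (hnil (hww₀ 0)) hν (Commute.all _ _)
    rwa [map_sub, h0, sub_add_cancel] at this
  · rw [mul_right_comm, ← hyxw, hy, mul_comm, ← mul_assoc, mono_mul_mono, add_neg_cancel,
      add_neg_cancel, mul_one, ← one_eq_mono, one_mul]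

end Decomposition

end Existence

section Factors

variable {R : Type*} [CommRing R] {p q r : ℤ × ℤ}

theorem toUnit_one : toUnit (1 : R) = 1 := by
  rw [toUnit, dif_pos isUnit_one, IsUnit.unit_one]

theorem coe_toUnit {x : R} (hx : IsUnit x) : (toUnit x : R) = x := by
  rw [toUnit, dif_pos hx, IsUnit.unit_spec]

theorem natCast_mul_natAbs_div {d : ℕ} {x : ℤ} (h : d ∣ x.natAbs) :
    (d : ℤ) * (x.natAbs / d : ℕ) = |x| := by
  rw [← Nat.cast_mul, Nat.mul_div_cancel' h, Int.natCast_natAbs]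

theorem natAbs_div_pos {d : ℕ} {x : ℤ} (hx : x ≠ 0) (h : d ∣ x.natAbs) : 0 < x.natAbs / d :=
  have hx' := Int.natAbs_pos.2 hx
  Nat.div_pos (Nat.le_of_dvd hx' h) (Nat.pos_of_dvd_of_pos h hx')

theorem natAbs_div_nsmul_add_eq_zero {M : Type*} [AddCommGroup M] [IsAddTorsionFree M] {d : ℕ}
    {x y z : ℤ} {p q r : M} (hd : d ≠ 0) (hx : d ∣ x.natAbs) (hy : d ∣ y.natAbs)
    (hz : d ∣ z.natAbs) (hsign : (0 ≤ x ∧ 0 ≤ y ∧ 0 ≤ z) ∨ (x ≤ 0 ∧ y ≤ 0 ∧ z ≤ 0))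
    (h : x • p + y • q + z • r = 0) :
    (x.natAbs / d) • p + (y.natAbs / d) • q + (z.natAbs / d) • r = 0 := by
  refine nsmul_right_injective hd ?_
  simp only [smul_zero, smul_add, ← natCast_zsmul, smul_smul, natCast_mul_natAbs_div hx,
    natCast_mul_natAbs_div hy, natCast_mul_natAbs_div hz]
  rcases hsign with ⟨hx, hy, hz⟩ | ⟨hx, hy, hz⟩
  · rwa [abs_of_nonneg hx, abs_of_nonneg hy, abs_of_nonneg hz]
  · rw [abs_of_nonpos hx, abs_of_nonpos hy, abs_of_nonpos hz, neg_smul, neg_smul, neg_smul,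
      ← neg_add, ← neg_add, h, neg_zero]

theorem det_smul_add_det_smul_add_det_smul (p q r : ℤ × ℤ) :
    det q r • p + det r p • q + det p q • r = 0 := by
  ext <;> simp only [det, Prod.fst_add, Prod.snd_add, Prod.smul_fst, Prod.smul_snd, smul_eq_mul,
    Prod.fst_zero, Prod.snd_zero] <;> ring

theorem exists_of_factorT_ne_one {a b c : R} (h : factorT p q r a b c ≠ 1) :
    ∃ α β γ : ℕ, 0 < α ∧ 0 < β ∧ 0 < γ ∧ α • p + β • q + γ • r = 0 ∧
      a ^ α * b ^ β * c ^ γ ≠ 0 := by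
  unfold factorT at h
  extract_lets p₀ q₀ r₀ d x at h
  have hsign : (0 < p₀ ∧ 0 < q₀ ∧ 0 < r₀) ∨ (p₀ < 0 ∧ q₀ < 0 ∧ r₀ < 0) := by
    by_contra! hs
    exact h (by grind)
  have hx : a ^ (p₀.natAbs / d) * b ^ (q₀.natAbs / d) * c ^ (r₀.natAbs / d) ≠ 0 := fun h0 => by
    have : x = 1 := by simp only [x, h0, sub_zero, toUnit_one]
    exact h (by simp [this])
  have hdp : d ∣ p₀.natAbs := Nat.gcd_dvd_left _ _
  have hdq : d ∣ q₀.natAbs := (Nat.gcd_dvd_right _ _).trans (Nat.gcd_dvd_left _ _)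
  have hdr : d ∣ r₀.natAbs := (Nat.gcd_dvd_right _ _).trans (Nat.gcd_dvd_right _ _)
  have hd : d ≠ 0 := (Nat.gcd_pos_of_pos_left _ (by omega)).ne'
  exact ⟨_, _, _, natAbs_div_pos (by omega) hdp, natAbs_div_pos (by omega) hdq,
    natAbs_div_pos (by omega) hdr, natAbs_div_nsmul_add_eq_zero hd hdp hdq hdr (by omega)
      (det_smul_add_det_smul_add_det_smul p q r), hx⟩

theorem mul_neg_of_mul_eq_mul_of_add_neg {i j k l : ℤ} (hdet : j * k = l * i)
    (hdot : j * l + i * k < 0) (hjl : j * l ≠ 0) : j * l < 0 := by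
  have hsq : (j * l) * (i * k) = (j * k) ^ 2 := by linear_combination (-(j * k)) * hdet
  by_contra! hpos
  nlinarith [sq_nonneg (j * k), lt_of_le_of_ne hpos hjl.symm]

theorem natAbs_div_gcd_nsmul_add_eq_zero {M : Type*} [AddCommGroup M] [IsAddTorsionFree M]
    {x y : ℤ} {p q : M} (hxy : x * y < 0) (h : x • p = y • q) :
    0 < x.natAbs / Int.gcd y x ∧ 0 < y.natAbs / Int.gcd y x ∧
      (x.natAbs / Int.gcd y x) • p + (y.natAbs / Int.gcd y x) • q = 0 := by
  have hx : x ≠ 0 := left_ne_zero_of_mul hxy.ne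
  have hy : y ≠ 0 := right_ne_zero_of_mul hxy.ne
  have hdx : Int.gcd y x ∣ x.natAbs := Nat.gcd_dvd_right _ _
  have hdy : Int.gcd y x ∣ y.natAbs := Nat.gcd_dvd_left _ _
  refine ⟨natAbs_div_pos hx hdx, natAbs_div_pos hy hdy, ?_⟩
  have := natAbs_div_nsmul_add_eq_zero (x := x) (y := -y) (z := 0) (p := p) (q := q) (r := 0)
    (Int.gcd_pos_of_ne_zero_left x hy).ne' hdx (by rwa [Int.natAbs_neg]) (by simp)
    (by rcases mul_neg_iff.1 hxy with h | h <;> omega) (by simp [h])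
  simpa only [Int.natAbs_neg, smul_zero, add_zero] using this

theorem exists_of_factorS_ne_one {a b : R} (h : factorS p q a b ≠ 1) :
    ∃ α β : ℕ, 0 < α ∧ 0 < β ∧ α • p + β • q = 0 ∧ a ^ α * b ^ β ≠ 0 := by
  unfold factorS at h
  extract_lets d at h
  split_ifs at h with hpq
  · obtain ⟨hdet, hdot, hne⟩ := hpq
    have hneg := mul_neg_of_mul_eq_mul_of_add_neg (sub_eq_zero.1 hdet) hdot hne
    obtain ⟨hα, hβ, h1⟩ := natAbs_div_gcd_nsmul_add_eq_zero (mul_comm p.2 q.2 ▸ hneg)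
      (show q.2 • p = p.2 • q from Prod.ext (sub_eq_zero.1 hdet).symm (mul_comm _ _))
    refine ⟨_, _, hα, hβ, h1, fun h0 => h ?_⟩
    rw [h0, sub_zero, toUnit_one, one_zpow]
  · exact absurd rfl h

theorem exists_of_factorQ_ne_one {a b : R} (h : factorQ p q a b ≠ 1) :
    ∃ α β : ℕ, 0 < α ∧ 0 < β ∧ α • p + β • q = 0 ∧ a ^ α * b ^ β ≠ 0 := by
  unfold factorQ at h
  extract_lets d at h
  split_ifs at h with hpq
  · obtain ⟨hdet, hdot, hne⟩ := hpq
    have hdet' : q.1 * p.2 = p.1 * q.2 := by linear_combination sub_eq_zero.1 hdet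
    have hneg := mul_neg_of_mul_eq_mul_of_add_neg (j := p.1) (l := q.1) (i := p.2) (k := q.2)
      hdet'.symm (by rwa [add_comm]) hne
    obtain ⟨hα, hβ, h1⟩ := natAbs_div_gcd_nsmul_add_eq_zero (mul_comm p.1 q.1 ▸ hneg)
      (show q.1 • p = p.1 • q from Prod.ext (mul_comm _ _) hdet')
    refine ⟨_, _, hα, hβ, h1, fun h0 => h ?_⟩
    rw [h0, sub_zero, toUnit_one, one_zpow]
  · exact absurd rfl h

theorem add_mem_posIdx (hp : p ∈ posIdx) (hq : q ∈ posIdx) : p + q ∈ posIdx := by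
  rw [mem_posIdx_iff] at *
  exact add_pos hp hq

theorem nsmul_mem_posIdx_of_pow_ne_zero {a : ℤ × ℤ → R} (ha : ∀ p ∉ posIdx, a p = 0) {α : ℕ}
    (hα : 0 < α) (h : a p ^ α ≠ 0) : α • p ∈ posIdx := by
  have hp : p ∈ posIdx := not_imp_comm.1 (ha p) (ne_zero_pow hα.ne' h)
  rw [mem_posIdx_iff] at *
  exact nsmul_pos hp hα.ne'

variable {a b c : ℤ × ℤ → R}

theorem famT_eq_one (ha : ∀ p ∉ posIdx, a p = 0) (hb : ∀ p ∉ posIdx, b p = 0)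
    (hc : ∀ p ∉ posIdx, c p = 0) : famT a b c = 1 := by
  funext x
  by_contra hx
  obtain ⟨α, β, γ, hα, hβ, hγ, h, h0⟩ := exists_of_factorT_ne_one hx
  have hab := left_ne_zero_of_mul h0
  refine zero_notMem_posIdx (h ▸ add_mem_posIdx (add_mem_posIdx ?_ ?_) ?_)
  · exact nsmul_mem_posIdx_of_pow_ne_zero ha hα (left_ne_zero_of_mul hab)
  · exact nsmul_mem_posIdx_of_pow_ne_zero hb hβ (right_ne_zero_of_mul hab)
  · exact nsmul_mem_posIdx_of_pow_ne_zero hc hγ (right_ne_zero_of_mul h0)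

theorem nsmul_add_nsmul_ne_zero (ha : ∀ p ∉ posIdx, a p = 0) (hb : ∀ p ∉ posIdx, b p = 0)
    {α β : ℕ} (hα : 0 < α) (hβ : 0 < β) (h : a p ^ α * b q ^ β ≠ 0) : α • p + β • q ≠ 0 :=
  fun h0 => zero_notMem_posIdx <| h0 ▸ add_mem_posIdx
    (nsmul_mem_posIdx_of_pow_ne_zero ha hα (left_ne_zero_of_mul h))
    (nsmul_mem_posIdx_of_pow_ne_zero hb hβ (right_ne_zero_of_mul h))

theorem famS_eq_one (ha : ∀ p ∉ posIdx, a p = 0) (hb : ∀ p ∉ posIdx, b p = 0) :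
    famS a b = 1 := by
  funext x
  by_contra hx
  obtain ⟨α, β, hα, hβ, h, h0⟩ := exists_of_factorS_ne_one hx
  exact nsmul_add_nsmul_ne_zero ha hb hα hβ h0 h

theorem famQ_eq_one (ha : ∀ p ∉ posIdx, a p = 0) (hb : ∀ p ∉ posIdx, b p = 0) :
    famQ a b = 1 := by
  funext x
  by_contra hx
  obtain ⟨α, β, hα, hβ, h, h0⟩ := exists_of_factorQ_ne_one hx
  exact nsmul_add_nsmul_ne_zero ha hb hα hβ h0 h

end Factors

section Reduced

variable {R : Type*} [CommRing R] [IsReduced R] {f g h : DoubleLaurent R}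

namespace Decomposition

theorem a_eq_zero_of_notMem_posIdx (F : Decomposition f) (p : ℤ × ℤ) (hp : p ∉ posIdx) :
    F.a p = 0 := by
  rcases mem_negIdx_or_eq_zero_or_mem_posIdx p with h | rfl | h
  · exact (F.a_nilpotent p h).eq_zero
  · exact F.a_zero
  · exact absurd h hp

theorem neg_eq_one (F : Decomposition f) : F.neg = 1 :=
  (F.neg_eq.congr fun p hp => (F.a_nilpotent p hp).eq_zero).unique hasInfiniteProduct_zero

theorem biCoeff_eq_unit_mul (F : Decomposition f) (q : ℤ × ℤ) :
    biCoeff q f = F.unit * biCoeff (q - F.ν) F.pos := by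
  conv_lhs => rw [F.eq_neg_mul_mul_pos, F.neg_eq_one, one_mul, biCoeff_mono_mul]

theorem finiteFactors_of_isReduced (F : Decomposition f) (G : Decomposition g)
    (H : Decomposition h) : F.FiniteFactors G H := by
  have hF := F.a_eq_zero_of_notMem_posIdx
  have hG := G.a_eq_zero_of_notMem_posIdx
  have hH := H.a_eq_zero_of_notMem_posIdx
  simp [FiniteFactors, famT_eq_one hF hG hH, famS_eq_one hF hG, famQ_eq_one hF hG,
    famS_eq_one hH hF, famQ_eq_one hH hF, famS_eq_one hG hH, famQ_eq_one hG hH]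

theorem symbol_of_isReduced (F : Decomposition f) (G : Decomposition g) (H : Decomposition h) :
    F.symbol G H = (-1) ^ signExp F.ν G.ν H.ν *
      (F.unit ^ det G.ν H.ν * G.unit ^ det H.ν F.ν * H.unit ^ det F.ν G.ν) := by
  have hF := F.a_eq_zero_of_notMem_posIdx
  have hG := G.a_eq_zero_of_notMem_posIdx
  have hH := H.a_eq_zero_of_notMem_posIdx
  simp [symbol, famT_eq_one hF hG hH, famS_eq_one hF hG, famQ_eq_one hF hG,
    famS_eq_one hH hF, famQ_eq_one hH hF, famS_eq_one hG hH, famQ_eq_one hG hH]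

end Decomposition

end Reduced

theorem existsUnique_and_symbol_eq {R : Type*} [CommRing R] {f g h : (DoubleLaurent R)ˣ} {s : R}
    (hs : IsUnit s) (H : ∀ c, IsSymbolValue f g h c ↔ (c : R) = s) :
    (∃! c : Rˣ, IsSymbolValue f g h c) ∧ (symbol f g h : R) = s :=
  ⟨⟨hs.unit, (H _).2 rfl, fun _ hc => Units.ext ((H _).1 hc)⟩,
    (H _).1 (Classical.epsilon_spec ⟨hs.unit, (H _).2 rfl⟩)⟩

section Field

theorem order_eq_of_coeff {A : Type*} [Zero A] {x : LaurentSeries A} {n : ℤ} (h : x.coeff n ≠ 0)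
    (h' : ∀ i < n, x.coeff i = 0) : x.order = n :=
  le_antisymm (HahnSeries.order_le_of_coeff_ne_zero h) <|
    (HahnSeries.le_order_iff_forall (HahnSeries.ne_zero_of_coeff_ne_zero h)).2 h'

variable {k : Type*} [Field k]

theorem biCoeff_val (x : DoubleLaurent k) : biCoeff (val x) x = x.leadingCoeff.leadingCoeff := by
  simp only [biCoeff_apply, val, HahnSeries.leadingCoeff_eq]

theorem biCoeff_val_add (x : DoubleLaurent k) {q : ℤ × ℤ} (hq : q ∈ negIdx) :
    biCoeff (val x + q) x = 0 := by
  rcases hq with hq | ⟨hq1, hq2⟩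
  · change (x.coeff (x.order + q.1)).coeff _ = 0
    rw [HahnSeries.coeff_eq_zero_of_lt_order (add_lt_of_neg_right _ hq), HahnSeries.coeff_zero]
  · rw [biCoeff_apply, Prod.fst_add, hq1, add_zero]
    change (x.coeff x.order).coeff _ = 0
    rw [← HahnSeries.leadingCoeff_eq]
    exact HahnSeries.coeff_eq_zero_of_lt_order (add_lt_of_neg_right _ hq2)

theorem val_eq_of_biCoeff {x : DoubleLaurent k} {ν : ℤ × ℤ} (h : biCoeff ν x ≠ 0)
    (h' : ∀ q ∈ negIdx, biCoeff (ν + q) x = 0) : val x = ν := by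
  have hfst : x.order = ν.1 := by
    refine order_eq_of_coeff (fun h0 => h (by simp [biCoeff_apply, h0])) fun i hi => ?_
    ext j
    simpa [biCoeff_apply] using h' (i - ν.1, j - ν.2) (Or.inl (sub_neg.2 hi))
  refine Prod.ext hfst ?_
  change x.leadingCoeff.order = ν.2
  rw [HahnSeries.leadingCoeff_eq, hfst]
  refine order_eq_of_coeff h fun j hj => ?_
  simpa [biCoeff_apply] using h' (0, j - ν.2) (Or.inr ⟨rfl, sub_neg.2 hj⟩)

variable (k) in
/-- The rank two valuation as a homomorphism. -/
noncomputable def valHom : (DoubleLaurent k)ˣ →* Multiplicative (ℤ × ℤ) where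
  toFun x := Multiplicative.ofAdd (val (x : DoubleLaurent k))
  map_one' := by simp [val, ofAdd_eq_one]
  map_mul' x y := by
    have hx : (x : DoubleLaurent k).leadingCoeff ≠ 0 := HahnSeries.leadingCoeff_ne_zero.2 x.ne_zero
    have hy : (y : DoubleLaurent k).leadingCoeff ≠ 0 := HahnSeries.leadingCoeff_ne_zero.2 y.ne_zero
    rw [← ofAdd_add, Units.val_mul, val, HahnSeries.order_mul x.ne_zero y.ne_zero,
      HahnSeries.leadingCoeff_mul, HahnSeries.order_mul hx hy]
    rfl

variable (k) in
/-- The leading coefficient in `u` of the leading coefficient in `t`, as a homomorphism. -/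
noncomputable def leadHom : (DoubleLaurent k)ˣ →* kˣ :=
  Units.map
    { toFun x := x.leadingCoeff.leadingCoeff
      map_one' := by simp
      map_mul' x y := by simp only [HahnSeries.leadingCoeff_mul] }

theorem coe_leadHom (x : (DoubleLaurent k)ˣ) :
    (leadHom k x : k) = biCoeff (val (x : DoubleLaurent k)) (x : DoubleLaurent k) :=
  (biCoeff_val _).symm

theorem tameSymbol_eq (f g h : (DoubleLaurent k)ˣ) {p q r : ℤ × ℤ}
    (hf : val (f : DoubleLaurent k) = p) (hg : val (g : DoubleLaurent k) = q)
    (hh : val (h : DoubleLaurent k) = r) :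
    tameSymbol f g h = (((-1) ^ signExp p q r *
      (leadHom k f ^ det q r * leadHom k g ^ det r p * leadHom k h ^ det p q) : kˣ) : k) := by
  unfold tameSymbol
  extract_lets vf vg vh w
  obtain rfl : vf = p := hf
  obtain rfl : vg = q := hg
  obtain rfl : vh = r := hh
  have hval : val (w : DoubleLaurent k) = 0 := by
    change (valHom k w).toAdd = 0
    simp only [w, map_mul, map_zpow, toAdd_mul, toAdd_zpow]
    exact det_smul_add_det_smul_add_det_smul vf vg vh
  have hlead : ((w : DoubleLaurent k).coeff 0).coeff 0 = (leadHom k w : k) := by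
    rw [coe_leadHom, hval]
    rfl
  rw [hlead, ← Units.val_mul]
  simp only [w, map_mul, map_zpow]

namespace Decomposition

theorem nonempty_of_field (f : (DoubleLaurent k)ˣ) :
    Nonempty (Decomposition (f : DoubleLaurent k)) :=
  nonempty_of_isUnit_biCoeff (pow_one ⊥) (val _) (coe_leadHom f ▸ (leadHom k f).isUnit)
    fun _ hq => biCoeff_val_add _ hq

variable {f g h : (DoubleLaurent k)ˣ}

theorem biCoeff_ν (F : Decomposition (f : DoubleLaurent k)) :
    biCoeff F.ν (f : DoubleLaurent k) = F.unit := by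
  rw [F.biCoeff_eq_unit_mul, sub_self, F.pos_eq.biCoeff_zero, mul_one]

theorem val_eq_ν (F : Decomposition (f : DoubleLaurent k)) : val (f : DoubleLaurent k) = F.ν :=
  val_eq_of_biCoeff (F.biCoeff_ν ▸ F.unit.ne_zero) fun q hq => by
    rw [F.biCoeff_eq_unit_mul, add_sub_cancel_left, F.pos_eq.mem_nonnegSubring q hq, mul_zero]

theorem leadHom_eq_unit (F : Decomposition (f : DoubleLaurent k)) : leadHom k f = F.unit :=
  Units.ext (by rw [coe_leadHom, F.val_eq_ν, F.biCoeff_ν])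

theorem coe_symbol_eq_tameSymbol (F : Decomposition (f : DoubleLaurent k))
    (G : Decomposition (g : DoubleLaurent k)) (H : Decomposition (h : DoubleLaurent k)) :
    (F.symbol G H : k) = tameSymbol f g h := by
  rw [tameSymbol_eq f g h F.val_eq_ν G.val_eq_ν H.val_eq_ν, F.symbol_of_isReduced,
    F.leadHom_eq_unit, G.leadHom_eq_unit, H.leadHom_eq_unit]

end Decomposition

theorem isUnit_tameSymbol (f g h : (DoubleLaurent k)ˣ) : IsUnit (tameSymbol f g h) := by
  rw [tameSymbol_eq f g h rfl rfl rfl]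
  exact Units.isUnit _

theorem isSymbolValue_iff_eq_tameSymbol {f g h : (DoubleLaurent k)ˣ} (c : kˣ) :
    IsSymbolValue f g h c ↔ (c : k) = tameSymbol f g h := by
  constructor
  · rintro ⟨F, G, H, -, rfl⟩
    exact F.coe_symbol_eq_tameSymbol G H
  · intro hc
    obtain ⟨F⟩ := Decomposition.nonempty_of_field f
    obtain ⟨G⟩ := Decomposition.nonempty_of_field g
    obtain ⟨H⟩ := Decomposition.nonempty_of_field h
    exact ⟨F, G, H, F.finiteFactors_of_isReduced G H,
      Units.ext (hc.trans (F.coe_symbol_eq_tameSymbol G H).symm)⟩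

end Field

section Finiteness

open scoped Pointwise

variable {U V W : Set (ℤ × ℤ)}

theorem IsLexPWO.union (hV : IsLexPWO V) (hW : IsLexPWO W) : IsLexPWO (V ∪ W) :=
  Set.IsPWO.union hV hW

theorem IsLexPWO.image_nsmul (hV : IsLexPWO V) (n : ℕ) : IsLexPWO ((n • ·) '' V) := by
  refine (Set.IsPWO.image_of_monotone hV (f := fun q : ℤ ×ₗ ℤ => n • q)
    fun p q hpq => nsmul_le_nsmul_right hpq n).mono ?_
  rintro q ⟨p, hp, hpq⟩
  exact ⟨toLex p, hp, by simpa using congrArg toLex hpq⟩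

theorem IsLexPWO.finite_add_add_eq_zero (hU : IsLexPWO U) (hV : IsLexPWO V) (hW : IsLexPWO W) :
    {x : (ℤ × ℤ) × (ℤ × ℤ) × (ℤ × ℤ) |
      x.1 ∈ U ∧ x.2.1 ∈ V ∧ x.2.2 ∈ W ∧ x.1 + x.2.1 + x.2.2 = 0}.Finite := by
  have hVW : IsLexPWO (V + W) := by
    refine (Set.IsPWO.add hV hW).mono ?_
    rintro _ ⟨q, hq, r, hr, hqr⟩
    exact ⟨toLex q, hq, toLex r, hr, congrArg toLex hqr⟩
  have hfin := (hU.finite_addAntidiagonal hVW 0).biUnion fun p _ =>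
    (hV.finite_addAntidiagonal hW (-p)).image fun q => (p, q, -p - q)
  refine hfin.subset ?_
  rintro ⟨p, q, r⟩ ⟨hp, hq, hr, h⟩
  dsimp only at hp hq hr h
  obtain rfl : r = -p - q := by rw [eq_neg_of_add_eq_zero_right h]; abel
  exact Set.mem_biUnion ⟨hp, q, hq, -p - q, hr, by simp⟩ ⟨q, ⟨hq, hr⟩, rfl⟩

theorem IsLexPWO.finite_nsmul_add_nsmul_add_nsmul_eq_zero (hU : IsLexPWO U) (hV : IsLexPWO V)
    (hW : IsLexPWO W) {α β γ : ℕ} (hα : α ≠ 0) (hβ : β ≠ 0) (hγ : γ ≠ 0) :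
    {x : (ℤ × ℤ) × (ℤ × ℤ) × (ℤ × ℤ) |
      x.1 ∈ U ∧ x.2.1 ∈ V ∧ x.2.2 ∈ W ∧ α • x.1 + β • x.2.1 + γ • x.2.2 = 0}.Finite := by
  have hinj : Injective (Prod.map (α • · : ℤ × ℤ → _)
      (Prod.map (β • · : ℤ × ℤ → _) (γ • · : ℤ × ℤ → _))) :=
    (nsmul_right_injective hα).prodMap
      ((nsmul_right_injective hβ).prodMap (nsmul_right_injective hγ))
  refine (((hU.image_nsmul α).finite_add_add_eq_zero (hV.image_nsmul β)
    (hW.image_nsmul γ)).preimage hinj.injOn).subset ?_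
  rintro x ⟨h1, h2, h3, h⟩
  exact ⟨⟨_, h1, rfl⟩, ⟨_, h2, rfl⟩, ⟨_, h3, rfl⟩, h⟩

theorem IsLexPWO.finite_of_exists_nsmul_add_eq_zero (hU : IsLexPWO U) (hV : IsLexPWO V)
    (hW : IsLexPWO W) {N : ℕ} {S : Set ((ℤ × ℤ) × (ℤ × ℤ) × (ℤ × ℤ))}
    (hS : ∀ x ∈ S, x.1 ∈ U ∧ x.2.1 ∈ V ∧ x.2.2 ∈ W ∧ ∃ α ∈ Set.Icc 1 N, ∃ β ∈ Set.Icc 1 N,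
      ∃ γ ∈ Set.Icc 1 N, α • x.1 + β • x.2.1 + γ • x.2.2 = 0) : S.Finite := by
  have hfin := ((Set.finite_Icc 1 N).prod ((Set.finite_Icc 1 N).prod (Set.finite_Icc 1 N))).biUnion
    fun n hn => hU.finite_nsmul_add_nsmul_add_nsmul_eq_zero hV hW
      (Nat.one_le_iff_ne_zero.1 hn.1.1) (Nat.one_le_iff_ne_zero.1 hn.2.1.1)
      (Nat.one_le_iff_ne_zero.1 hn.2.2.1)
  refine hfin.subset fun x hx => ?_
  obtain ⟨h1, h2, h3, α, hα, β, hβ, γ, hγ, h⟩ := hS x hx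
  exact Set.mem_biUnion (x := (α, β, γ)) ⟨hα, hβ, hγ⟩ ⟨h1, h2, h3, h⟩

variable {R : Type*} [CommRing R] {I : Ideal R} {N : ℕ} {a b c : ℤ × ℤ → R}

theorem le_of_pow_ne_zero (hI : I ^ N = ⊥) {r : R} (hr : r ∈ I) {n : ℕ} (h : r ^ n ≠ 0) :
    n ≤ N := by
  by_contra! hlt
  exact h (by simpa [hI] using Ideal.pow_le_pow_right hlt.le (Ideal.pow_mem_pow hr n))

theorem finite_mulSupport_famT (hI : I ^ N = ⊥) (ha : IsLexPWO (support a))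
    (hb : IsLexPWO (support b)) (hc : IsLexPWO (support c)) (haI : ∀ p, a p ∈ I)
    (hbI : ∀ p, b p ∈ I) (hcI : ∀ p, c p ∈ I) : (mulSupport (famT a b c)).Finite := by
  refine ha.finite_of_exists_nsmul_add_eq_zero hb hc (N := N) fun x hx => ?_
  obtain ⟨α, β, γ, hα, hβ, hγ, h, h0⟩ := exists_of_factorT_ne_one hx
  have hab := left_ne_zero_of_mul h0
  have ha0 := left_ne_zero_of_mul hab
  have hb0 := right_ne_zero_of_mul hab
  have hc0 := right_ne_zero_of_mul h0
  exact ⟨ne_zero_pow hα.ne' ha0, ne_zero_pow hβ.ne' hb0, ne_zero_pow hγ.ne' hc0,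
    α, ⟨hα, le_of_pow_ne_zero hI (haI _) ha0⟩, β, ⟨hβ, le_of_pow_ne_zero hI (hbI _) hb0⟩,
    γ, ⟨hγ, le_of_pow_ne_zero hI (hcI _) hc0⟩, h⟩

theorem finite_mulSupport_of_exists_pow_mul_pow_ne_zero {M : Type*} [One M] (hI : I ^ N = ⊥)
    (ha : IsLexPWO (support a)) (hb : IsLexPWO (support b))
    (haI : ∀ p, a p ∈ I) (hbI : ∀ p, b p ∈ I) {φ : (ℤ × ℤ) × (ℤ × ℤ) → M}
    (hφ : ∀ x, φ x ≠ 1 → ∃ α β : ℕ, 0 < α ∧ 0 < β ∧ α • x.1 + β • x.2 = 0 ∧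
      a x.1 ^ α * b x.2 ^ β ≠ 0) : (mulSupport φ).Finite := by
  have hinj : Injective fun x : (ℤ × ℤ) × (ℤ × ℤ) => (x.1, x.2, (0 : ℤ × ℤ)) := by
    rintro ⟨p, q⟩ ⟨p', q'⟩ h
    simpa using h
  refine Set.Finite.of_finite_image (ha.finite_of_exists_nsmul_add_eq_zero hb
    (isLexPWO_of_finite (Set.finite_singleton 0)) (N := N) ?_) hinj.injOn
  rintro _ ⟨x, hx, rfl⟩
  obtain ⟨α, β, hα, hβ, h, h0⟩ := hφ x hx
  have ha0 := left_ne_zero_of_mul h0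
  have hb0 := right_ne_zero_of_mul h0
  have hαN := le_of_pow_ne_zero hI (haI _) ha0
  exact ⟨ne_zero_pow hα.ne' ha0, ne_zero_pow hβ.ne' hb0, rfl, α, ⟨hα, hαN⟩,
    β, ⟨hβ, le_of_pow_ne_zero hI (hbI _) hb0⟩, 1, ⟨le_rfl, hα.trans_le hαN⟩, by simpa using h⟩

theorem finite_mulSupport_famS (hI : I ^ N = ⊥) (ha : IsLexPWO (support a))
    (hb : IsLexPWO (support b)) (haI : ∀ p, a p ∈ I) (hbI : ∀ p, b p ∈ I) :
    (mulSupport (famS a b)).Finite :=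
  finite_mulSupport_of_exists_pow_mul_pow_ne_zero hI ha hb haI hbI fun _ =>
    exists_of_factorS_ne_one

theorem finite_mulSupport_famQ (hI : I ^ N = ⊥) (ha : IsLexPWO (support a))
    (hb : IsLexPWO (support b)) (haI : ∀ p, a p ∈ I) (hbI : ∀ p, b p ∈ I) :
    (mulSupport (famQ a b)).Finite :=
  finite_mulSupport_of_exists_pow_mul_pow_ne_zero hI ha hb haI hbI fun _ =>
    exists_of_factorQ_ne_one

theorem Decomposition.isLexPWO_support {f : DoubleLaurent R} (F : Decomposition f) :
    IsLexPWO (support F.a) := by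
  obtain ⟨i₀, j₀, hneg⟩ := F.a_bounded
  have hlt : IsLexPWO {p ∈ negIdx | F.a p ≠ 0} :=
    isLexPWO_of_bounded fun p hp => ⟨(hneg p hp.1 hp.2).1.le, (hneg p hp.1 hp.2).2.le⟩
  refine (hlt.union F.pos_eq.isLexPWO_support).mono fun p hp => ?_
  rcases mem_negIdx_or_eq_zero_or_mem_posIdx p with h | rfl | h
  · exact Or.inl ⟨h, hp⟩
  · exact absurd F.a_zero hp
  · exact Or.inr ⟨h, hp⟩

theorem Decomposition.finiteFactors_of_mem (hI : I ^ N = ⊥) {f g h : DoubleLaurent R}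
    {F : Decomposition f} {G : Decomposition g} {H : Decomposition h} (hF : ∀ p, F.a p ∈ I)
    (hG : ∀ p, G.a p ∈ I) (hH : ∀ p, H.a p ∈ I) : F.FiniteFactors G H :=
  have hf := F.isLexPWO_support
  have hg := G.isLexPWO_support
  have hh := H.isLexPWO_support
  ⟨finite_mulSupport_famT hI hf hg hh hF hG hH,
    finite_mulSupport_famS hI hf hg hF hG, finite_mulSupport_famQ hI hf hg hF hG,
    finite_mulSupport_famS hI hh hf hH hF, finite_mulSupport_famQ hI hh hf hH hF,
    finite_mulSupport_famS hI hg hh hG hH, finite_mulSupport_famQ hI hg hh hG hH⟩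

end Finiteness

section ResidueSum

variable {R : Type*} [CommRing R]

/-- `Res (f dg ∧ dh)`, written as a sum over the triples of indices with sum zero. In this form it
makes sense over every commutative ring, and it can be compared factor by factor with the symbol. -/
noncomputable def residueSum (f g h : DoubleLaurent R) : R :=
  ∑ᶠ z : (ℤ × ℤ) × (ℤ × ℤ),
    (det z.2 (-z.1 - z.2) : R) * (biCoeff z.1 f * biCoeff z.2 g * biCoeff (-z.1 - z.2) h)

theorem prodMk_neg_sub_injective :
    Injective fun z : (ℤ × ℤ) × (ℤ × ℤ) => (z.1, z.2, -z.1 - z.2) := by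
  rintro ⟨p, q⟩ ⟨p', q'⟩ h
  simp only [Prod.mk.injEq] at h
  rw [h.1, h.2.1]

theorem finite_support_residueSum (f g h : DoubleLaurent R) :
    (support fun z : (ℤ × ℤ) × (ℤ × ℤ) => (det z.2 (-z.1 - z.2) : R) *
      (biCoeff z.1 f * biCoeff z.2 g * biCoeff (-z.1 - z.2) h)).Finite := by
  refine (((isLexPWO_support f).finite_add_add_eq_zero (isLexPWO_support g)
    (isLexPWO_support h)).preimage prodMk_neg_sub_injective.injOn).subset fun z hz => ?_
  have hprod := right_ne_zero_of_mul hz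
  have hfg := left_ne_zero_of_mul hprod
  exact ⟨left_ne_zero_of_mul hfg, right_ne_zero_of_mul hfg, right_ne_zero_of_mul hprod, by
    dsimp only; abel⟩

theorem ne_zero_of_det_neg_sub_ne_zero {p q : ℤ × ℤ} (h : det q (-p - q) ≠ 0) :
    p ≠ 0 ∧ q ≠ 0 ∧ -p - q ≠ 0 := by
  refine ⟨?_, ?_, fun h0 => h (by simp [h0, det])⟩
  · rintro rfl
    exact h (by simp [det, mul_comm])
  · rintro rfl
    exact h (by simp [det])

end ResidueSum

section ResidueFormula

variable {k : Type*} [Field k]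

theorem biCoeff_derivT (q : ℤ × ℤ) (x : DoubleLaurent k) :
    biCoeff q (derivT x) = (q.1 + 1 : ℤ) * biCoeff (q + (1, 0)) x := by
  rw [biCoeff_apply, derivT, LaurentSeries.derivative_apply, LaurentSeries.hasseDeriv_coeff,
    Ring.choose_one_right, ← zsmul_eq_mul, biCoeff_apply, Prod.snd_add, add_zero]
  exact map_zsmul (HahnSeries.coeff.addMonoidHom q.2) (q.1 + 1) (x.coeff (q.1 + 1))

theorem biCoeff_derivU (q : ℤ × ℤ) (x : DoubleLaurent k) :
    biCoeff q (derivU x) = (q.2 + 1 : ℤ) * biCoeff (q + (0, 1)) x := by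
  rw [biCoeff_apply, derivU, HahnSeries.map_coeff, biCoeff_apply]
  change (LaurentSeries.derivative k (x.coeff q.1)).coeff q.2 = _
  rw [LaurentSeries.derivative_apply, LaurentSeries.hasseDeriv_coeff]
  simp

theorem biCoeff_derivU_mul_derivT (x y : DoubleLaurent k) (s : ℤ × ℤ) :
    biCoeff (s - (1, 1)) (derivU x * derivT y) =
      ∑ᶠ q : ℤ × ℤ, ((q.2 * (s - q).1 : ℤ) : k) * (biCoeff q x * biCoeff (s - q) y) := by
  rw [biCoeff_mul, ← finsum_comp_equiv (Equiv.subRight ((0, 1) : ℤ × ℤ))]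
  refine finsum_congr fun q => ?_
  have hq : s - (1, 1) - (q - (0, 1)) + (1, 0) = s - q :=
    Prod.ext (by simp; ring) (by simp)
  have hq₂ : (q - ((0, 1) : ℤ × ℤ)).2 + 1 = q.2 := by simp
  have hq₁ : (s - (1, 1) - (q - (0, 1)) : ℤ × ℤ).1 + 1 = (s - q).1 := by
    simp only [Prod.fst_sub]
    ring
  rw [Equiv.subRight_apply, biCoeff_derivU, biCoeff_derivT, sub_add_cancel, hq, hq₂, hq₁]
  push_cast
  ring

theorem biCoeff_derivU_mul_derivT_sub (g h : DoubleLaurent k) (s : ℤ × ℤ) :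
    biCoeff (s - (1, 1)) (derivU g * derivT h - derivU h * derivT g) =
      ∑ᶠ q, (det q (s - q) : k) * (biCoeff q g * biCoeff (s - q) h) := by
  have hswap : biCoeff (s - (1, 1)) (derivU h * derivT g) =
      ∑ᶠ q, (((s - q).2 * q.1 : ℤ) : k) * (biCoeff q g * biCoeff (s - q) h) := by
    rw [biCoeff_derivU_mul_derivT, ← finsum_comp_equiv (Equiv.subLeft s)]
    refine finsum_congr fun q => ?_
    rw [Equiv.subLeft_apply, sub_sub_cancel, mul_comm (biCoeff _ h)]
  have hfin (w : ℤ × ℤ → k) :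
      (support fun q => w q * (biCoeff q g * biCoeff (s - q) h)).Finite :=
    (finite_support_mul g h s).subset fun q (hq : w q * _ ≠ 0) => right_ne_zero_of_mul hq
  rw [map_sub, hswap, biCoeff_derivU_mul_derivT, ← finsum_sub_distrib (hfin _) (hfin _)]
  refine finsum_congr fun q => ?_
  rw [← sub_mul, ← Int.cast_sub, det]

theorem resWedge_eq_residueSum (f g h : DoubleLaurent k) :
    resWedge f g h = residueSum f g h := by
  rw [residueSum, finsum_curry _ (finite_support_residueSum f g h)]
  change biCoeff (-1, -1) _ = _
  rw [biCoeff_mul]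
  refine finsum_congr fun p => ?_
  have hp : ((-1, -1) : ℤ × ℤ) - p = -p - (1, 1) := by ext <;> simp <;> ring
  rw [hp, biCoeff_derivU_mul_derivT_sub, mul_finsum]
  exact finsum_congr fun q => by ring

end ResidueFormula

section SquareZero

variable {R : Type*} [CommRing R]

theorem coe_toUnit_one_sub_zpow {y : R} (hy : y * y = 0) (n : ℤ) :
    ((toUnit (1 - y) ^ n : Rˣ) : R) = 1 - n * y := by
  have hunit : IsUnit (1 - y) := IsNilpotent.isUnit_one_sub ⟨2, by rw [sq, hy]⟩
  have hpow (m : ℕ) : ((toUnit (1 - y) ^ m : Rˣ) : R) = 1 - m * y := by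
    induction m with
    | zero => simp
    | succ m ih =>
      rw [pow_succ, Units.val_mul, ih, coe_toUnit hunit]
      push_cast
      linear_combination (m : R) * hy
  obtain ⟨m, rfl | rfl⟩ := n.eq_nat_or_neg
  · rw [zpow_natCast, hpow, Int.cast_natCast]
  · rw [zpow_neg, zpow_natCast]
    refine Units.inv_eq_of_mul_eq_one_right ?_
    rw [hpow]
    push_cast
    linear_combination -(m : R) ^ 2 * hy

theorem coe_factorT_neg_sub {p q : ℤ × ℤ} {a b c : R} (h : (a * b * c) * (a * b * c) = 0) :
    (factorT p q (-p - q) a b c : R) = 1 - det q (-p - q) * (a * b * c) := by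
  have h1 : det (-p - q) p = det q (-p - q) := by simp [det]; ring
  have h2 : det p q = det q (-p - q) := by simp [det]; ring
  unfold factorT
  rw [h1, h2]
  generalize det q (-p - q) = n
  simp only [and_self, Nat.gcd_self]
  rcases lt_trichotomy n 0 with hn | rfl | hn
  · rw [if_neg hn.not_gt, if_pos hn, Nat.div_self (Int.natAbs_pos.2 hn.ne), pow_one, pow_one,
      pow_one, Int.natCast_natAbs, abs_of_neg hn, neg_neg, coe_toUnit_one_sub_zpow h]
  · simp
  · rw [if_pos hn, Nat.div_self (Int.natAbs_pos.2 hn.ne'), pow_one, pow_one,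
      pow_one, Int.natCast_natAbs, abs_of_pos hn, coe_toUnit_one_sub_zpow h]

theorem finprod_one_add {ι : Type*} {x : ι → R} (hfin : (support x).Finite)
    (hx : ∀ i j, x i * x j = 0) : ∏ᶠ i, (1 + x i) = 1 + ∑ᶠ i, x i := by
  have hprod (s : Finset ι) : ∏ i ∈ s, (1 + x i) = 1 + ∑ i ∈ s, x i := by
    induction s using Finset.cons_induction with
    | empty => simp
    | cons i s hi ih =>
      have hsum : x i * ∑ j ∈ s, x j = 0 := by
        rw [Finset.mul_sum, Finset.sum_eq_zero fun j _ => hx i j]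
      rw [Finset.prod_cons, Finset.sum_cons, ih]
      linear_combination hsum
  rw [finsum_eq_sum_of_support_subset x hfin.coe_toFinset.ge, ← hprod]
  refine finprod_eq_prod_of_mulSupport_subset _ fun i hi => hfin.mem_toFinset.2 fun h0 => hi ?_
  simp [h0]

variable {I : Ideal R}

theorem mul_mul_mem_pow_three {a b c : R} (ha : a ∈ I) (hb : b ∈ I) (hc : c ∈ I) :
    a * b * c ∈ I ^ 3 := by
  rw [pow_succ, sq]
  exact Ideal.mul_mem_mul (Ideal.mul_mem_mul ha hb) hc

theorem mul_eq_zero_of_mem_pow_three (hI : I ^ 4 = ⊥) {x y : R} (hx : x ∈ I ^ 3)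
    (hy : y ∈ I ^ 3) : x * y = 0 := by
  have hxy : x * y ∈ I ^ 4 := by
    rw [pow_succ]
    exact Ideal.mul_mem_mul hx (Ideal.pow_le_self three_ne_zero hy)
  simpa [hI] using hxy

theorem mul_mul_eq_neg_of_add_mem_sq (hI : I ^ 4 = ⊥) {a b c x y z : R} (hx : x ∈ I) (hy : y ∈ I)
    (hb : b ∈ I) (hc : c ∈ I) (hxa : x + a ∈ I ^ 2) (hyb : y + b ∈ I ^ 2) (hzc : z + c ∈ I ^ 2) :
    a * b * c = -(x * y * z) := by
  have h4 {u v w : R} (hu : u ∈ I ^ 2) (hv : v ∈ I) (hw : w ∈ I) : u * v * w = 0 := by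
    have := Ideal.mul_mem_mul (Ideal.mul_mem_mul hu hv) hw
    rwa [← pow_succ, ← pow_succ, hI, Ideal.mem_bot] at this
  linear_combination h4 hxa hb hc - h4 hyb hx hc + h4 hzc hx hy

theorem eq_one_of_pow_mul_pow_mul_pow_ne_zero (hI : I ^ 4 = ⊥) {a b c : R} (ha : a ∈ I)
    (hb : b ∈ I) (hc : c ∈ I) {α β γ : ℕ} (hα : 0 < α) (hβ : 0 < β) (hγ : 0 < γ)
    (h : a ^ α * b ^ β * c ^ γ ≠ 0) : α = 1 ∧ β = 1 ∧ γ = 1 := by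
  have hlt : α + β + γ < 4 := by
    by_contra! hle
    have hmem := Ideal.mul_mem_mul (Ideal.mul_mem_mul (Ideal.pow_mem_pow ha α)
      (Ideal.pow_mem_pow hb β)) (Ideal.pow_mem_pow hc γ)
    rw [← pow_add, ← pow_add] at hmem
    exact h (by simpa [hI] using Ideal.pow_le_pow_right hle hmem)
  lia

end SquareZero

section InfinitesimalSymbol

variable {R : Type*} [CommRing R] {f g h : DoubleLaurent R}

theorem biCoeff_mem_of_sub_one_mem {I : Ideal R} (hf : f - 1 ∈ coeffIdeal I) {p : ℤ × ℤ}
    (hp : p ≠ 0) : biCoeff p f ∈ I := by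
  have := hf p
  rwa [map_sub, biCoeff_one, if_neg hp, sub_zero] at this

theorem mulSupport_famT_subset_range {I : Ideal R} (hI : I ^ 4 = ⊥) {a b c : ℤ × ℤ → R}
    (ha : ∀ p, a p ∈ I) (hb : ∀ p, b p ∈ I) (hc : ∀ p, c p ∈ I) :
    mulSupport (famT a b c) ⊆
      Set.range fun z : (ℤ × ℤ) × (ℤ × ℤ) => (z.1, z.2, -z.1 - z.2) := by
  rintro ⟨p, q, r⟩ hx
  obtain ⟨α, β, γ, hα, hβ, hγ, hsum, h0⟩ := exists_of_factorT_ne_one hx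
  obtain ⟨rfl, rfl, rfl⟩ :=
    eq_one_of_pow_mul_pow_mul_pow_ne_zero hI (ha _) (hb _) (hc _) hα hβ hγ h0
  simp only [one_smul] at hsum
  exact ⟨(p, q), by simp only [eq_neg_of_add_eq_zero_right hsum, neg_add, sub_eq_add_neg]⟩

theorem finprod_famT_eq {I : Ideal R} (hI : I ^ 4 = ⊥) {a b c : ℤ × ℤ → R}
    (ha : ∀ p, a p ∈ I) (hb : ∀ p, b p ∈ I) (hc : ∀ p, c p ∈ I) :
    ∏ᶠ x, famT a b c x = ∏ᶠ z : (ℤ × ℤ) × (ℤ × ℤ), famT a b c (z.1, z.2, -z.1 - z.2) := by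
  rw [← finprod_mem_range prodMk_neg_sub_injective, ← finprod_mem_univ]
  exact finprod_mem_inter_mulSupport_eq' _ _ _ fun x hx =>
    iff_of_true (Set.mem_univ x) (mulSupport_famT_subset_range hI ha hb hc hx)

theorem det_mul_biCoeff_mul_mem {I : Ideal R} (hf : f - 1 ∈ coeffIdeal I)
    (hg : g - 1 ∈ coeffIdeal I) (hh : h - 1 ∈ coeffIdeal I) (p q : ℤ × ℤ) :
    (det q (-p - q) : R) * (biCoeff p f * biCoeff q g * biCoeff (-p - q) h) ∈ I ^ 3 := by
  by_cases hdet : det q (-p - q) = 0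
  · simp [hdet]
  · obtain ⟨hp, hq, hr⟩ := ne_zero_of_det_neg_sub_ne_zero hdet
    exact Ideal.mul_mem_left _ _ (mul_mul_mem_pow_three (biCoeff_mem_of_sub_one_mem hf hp)
      (biCoeff_mem_of_sub_one_mem hg hq) (biCoeff_mem_of_sub_one_mem hh hr))

namespace Decomposition

variable {F : Decomposition f} {G : Decomposition g} {H : Decomposition h} {I : Ideal R}

theorem coe_famT_neg_sub (hI : nilradical R ≤ I) (hI4 : I ^ 4 = ⊥) (hF : F.ν = 0) (hG : G.ν = 0)
    (hH : H.ν = 0) (hf : f - 1 ∈ coeffIdeal I) (hg : g - 1 ∈ coeffIdeal I)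
    (hh : h - 1 ∈ coeffIdeal I) (p q : ℤ × ℤ) :
    (famT F.a G.a H.a (p, q, -p - q) : R) =
      1 + det q (-p - q) * (biCoeff p f * biCoeff q g * biCoeff (-p - q) h) := by
  have ha := a_mem_of_sub_one_mem hI hF hf
  have hb := a_mem_of_sub_one_mem hI hG hg
  have hc := a_mem_of_sub_one_mem hI hH hh
  have habc := mul_mul_mem_pow_three (ha p) (hb q) (hc (-p - q))
  refine (coe_factorT_neg_sub (mul_eq_zero_of_mem_pow_three hI4 habc habc)).trans ?_
  by_cases hdet : det q (-p - q) = 0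
  · simp [hdet]
  · obtain ⟨hp, hq, hr⟩ := ne_zero_of_det_neg_sub_ne_zero hdet
    rw [mul_mul_eq_neg_of_add_mem_sq hI4 (biCoeff_mem_of_sub_one_mem hf hp)
      (biCoeff_mem_of_sub_one_mem hg hq) (hb q) (hc _) (biCoeff_add_a_mem_sq hI hF hf hp)
      (biCoeff_add_a_mem_sq hI hG hg hq) (biCoeff_add_a_mem_sq hI hH hh hr)]
    ring

theorem coe_finprod_famT (hI : nilradical R ≤ I) (hI4 : I ^ 4 = ⊥) (hF : F.ν = 0) (hG : G.ν = 0)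
    (hH : H.ν = 0) (hf : f - 1 ∈ coeffIdeal I) (hg : g - 1 ∈ coeffIdeal I)
    (hh : h - 1 ∈ coeffIdeal I) :
    ((∏ᶠ x, famT F.a G.a H.a x : Rˣ) : R) = 1 + residueSum f g h := by
  rw [finprod_famT_eq hI4 (a_mem_of_sub_one_mem hI hF hf) (a_mem_of_sub_one_mem hI hG hg)
    (a_mem_of_sub_one_mem hI hH hh), ← Units.coeHom_apply,
    (Units.coeHom R).map_finprod_of_injective Units.val_injective, residueSum,
    ← finprod_one_add (finite_support_residueSum f g h)]
  · exact finprod_congr fun z => coe_famT_neg_sub hI hI4 hF hG hH hf hg hh z.1 z.2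
  · exact fun z w => mul_eq_zero_of_mem_pow_three hI4 (det_mul_biCoeff_mul_mem hf hg hh _ _)
      (det_mul_biCoeff_mul_mem hf hg hh _ _)

theorem symbol_eq_finprod_famT (hF : F.ν = 0) (hG : G.ν = 0) (hH : H.ν = 0) :
    F.symbol G H = ∏ᶠ x, famT F.a G.a H.a x := by
  obtain ⟨hF₁, hF₂⟩ := Prod.ext_iff.1 hF
  obtain ⟨hG₁, hG₂⟩ := Prod.ext_iff.1 hG
  obtain ⟨hH₁, hH₂⟩ := Prod.ext_iff.1 hH
  simp only [ν, Prod.fst_zero, Prod.snd_zero] at hF₁ hF₂ hG₁ hG₂ hH₁ hH₂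
  simp [symbol, hF, hG, hH, hF₁, hF₂, hG₁, hG₂, hH₁, hH₂, signExp, det]

theorem nonempty_of_sub_one_mem {N : ℕ} (hI : I ^ N = ⊥) (hf : f - 1 ∈ coeffIdeal I) :
    Nonempty (Decomposition f) := by
  refine nonempty_of_isUnit_biCoeff hI 0 ?_ fun q hq => ?_
  · have h0 := hf 0
    rw [map_sub, biCoeff_one, if_pos rfl] at h0
    have hnil : IsNilpotent (biCoeff 0 f - 1) := ⟨N, by simpa [hI] using Ideal.pow_mem_pow h0 N⟩
    simpa using hnil.isUnit_one_add
  · rw [zero_add]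
    exact biCoeff_mem_of_sub_one_mem hf fun h0 => zero_notMem_negIdx (h0 ▸ hq)

end Decomposition

theorem nilradical_ne_top [Nontrivial R] : nilradical R ≠ ⊤ := fun h => by
  have h1 : (1 : R) ∈ nilradical R := h ▸ Submodule.mem_top
  exact not_isNilpotent_one h1

theorem isSymbolValue_iff_eq_one_add_residueSum [Nontrivial R] {f g h : (DoubleLaurent R)ˣ}
    (hN : nilradical R ^ 4 = ⊥) (hf : (f : DoubleLaurent R) - 1 ∈ coeffIdeal (nilradical R))
    (hg : (g : DoubleLaurent R) - 1 ∈ coeffIdeal (nilradical R))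
    (hh : (h : DoubleLaurent R) - 1 ∈ coeffIdeal (nilradical R)) (c : Rˣ) :
    IsSymbolValue f g h c ↔ (c : R) = 1 + residueSum (f : DoubleLaurent R) g h := by
  have hν {y : DoubleLaurent R} (hy : y - 1 ∈ coeffIdeal (nilradical R)) (Y : Decomposition y) :
      Y.ν = 0 :=
    Y.ν_eq_zero_of_sub_one_mem le_rfl nilradical_ne_top hy
  have hval (F : Decomposition (f : DoubleLaurent R)) (G : Decomposition (g : DoubleLaurent R))
      (H : Decomposition (h : DoubleLaurent R)) :
      (F.symbol G H : R) = 1 + residueSum (f : DoubleLaurent R) g h := by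
    rw [Decomposition.symbol_eq_finprod_famT (hν hf F) (hν hg G) (hν hh H),
      Decomposition.coe_finprod_famT le_rfl hN (hν hf F) (hν hg G) (hν hh H) hf hg hh]
  constructor
  · rintro ⟨F, G, H, -, rfl⟩
    exact hval F G H
  · intro hc
    obtain ⟨F⟩ := Decomposition.nonempty_of_sub_one_mem hN hf
    obtain ⟨G⟩ := Decomposition.nonempty_of_sub_one_mem hN hg
    obtain ⟨H⟩ := Decomposition.nonempty_of_sub_one_mem hN hh
    exact ⟨F, G, H, Decomposition.finiteFactors_of_mem hN
      (F.a_mem_of_sub_one_mem le_rfl (hν hf F) hf) (G.a_mem_of_sub_one_mem le_rfl (hν hg G) hg)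
      (H.a_mem_of_sub_one_mem le_rfl (hν hh H) hh), Units.ext (hc.trans (hval F G H).symm)⟩

end InfinitesimalSymbol

section TruncatedRing

variable {k : Type*} [Field k]

theorem nilradical_trunc : nilradical (Trunc k) = Ideal.span {eps k} := by
  refine le_antisymm (fun x hx => ?_) ?_
  · obtain ⟨p, rfl⟩ := AdjoinRoot.mk_surjective x
    obtain ⟨n, hn⟩ := mem_nilradical.1 hx
    rw [← map_pow, AdjoinRoot.mk_eq_zero] at hn
    obtain ⟨q, rfl⟩ := Polynomial.prime_X.dvd_of_dvd_pow ((dvd_pow_self _ four_ne_zero).trans hn)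
    exact Ideal.mem_span_singleton.2 ⟨AdjoinRoot.mk _ q, by rw [map_mul, AdjoinRoot.mk_X, eps]⟩
  · rw [Ideal.span_singleton_le_iff_mem]
    exact ⟨4, eps_pow_four k⟩

theorem nilradical_trunc_pow_four : nilradical (Trunc k) ^ 4 = ⊥ := by
  rw [nilradical_trunc, Ideal.span_singleton_pow, eps_pow_four, Ideal.span_singleton_eq_bot]

theorem biCoeff_oneAddEps_sub_one (f : DoubleLaurent k) (q : ℤ × ℤ) :
    biCoeff q ((oneAddEps f : DoubleLaurent (Trunc k)) - 1) =
      eps k * algebraMap k (Trunc k) (biCoeff q f) := by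
  have hsub : (oneAddEps f : DoubleLaurent (Trunc k)) - 1 = mono 0 0 (eps k) * extend f :=
    add_sub_cancel_left _ _
  rw [hsub, biCoeff_mono_mul, show q - (0, 0) = q from sub_zero q]
  rfl

theorem oneAddEps_sub_one_mem (f : DoubleLaurent k) :
    (oneAddEps f : DoubleLaurent (Trunc k)) - 1 ∈ coeffIdeal (nilradical (Trunc k)) := fun q => by
  rw [biCoeff_oneAddEps_sub_one, nilradical_trunc]
  exact Ideal.mul_mem_right _ _ (Ideal.mem_span_singleton_self _)

theorem biCoeff_oneAddEps (f : DoubleLaurent k) {q : ℤ × ℤ} (hq : q ≠ 0) :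
    biCoeff q (oneAddEps f : DoubleLaurent (Trunc k)) =
      eps k * algebraMap k (Trunc k) (biCoeff q f) := by
  rw [← biCoeff_oneAddEps_sub_one, map_sub, biCoeff_one, if_neg hq, sub_zero]

theorem residueSum_oneAddEps (f g h : DoubleLaurent k) :
    residueSum (oneAddEps f : DoubleLaurent (Trunc k)) (oneAddEps g) (oneAddEps h) =
      eps k ^ 3 * algebraMap k (Trunc k) (residueSum f g h) := by
  let φ : k →+ Trunc k := (AddMonoidHom.mulLeft (eps k ^ 3)).comp (algebraMap k (Trunc k))
  refine Eq.trans (finsum_congr fun z => ?_) (φ.map_finsum (finite_support_residueSum f g h)).symm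
  change _ = eps k ^ 3 * algebraMap k (Trunc k) _
  by_cases hdet : det z.2 (-z.1 - z.2) = 0
  · simp [hdet]
  · obtain ⟨hp, hq, hr⟩ := ne_zero_of_det_neg_sub_ne_zero hdet
    rw [biCoeff_oneAddEps f hp, biCoeff_oneAddEps g hq, biCoeff_oneAddEps h hr]
    simp only [map_mul, map_intCast]
    ring

theorem isUnit_one_add_eps (c : k) : IsUnit (1 + eps k ^ 3 * algebraMap k (Trunc k) c) :=
  IsNilpotent.isUnit_one_add
    ((Commute.all _ _).isNilpotent_mul_right (IsNilpotent.pow_of_pos ⟨4, eps_pow_four k⟩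
      three_ne_zero))

theorem isSymbolValue_oneAddEps_iff {f g h : DoubleLaurent k} (c : (Trunc k)ˣ) :
    IsSymbolValue (oneAddEps f) (oneAddEps g) (oneAddEps h) c ↔
      (c : Trunc k) = 1 + eps k ^ 3 * algebraMap k (Trunc k) (resWedge f g h) := by
  have : Nontrivial (Trunc k) := AdjoinRoot.nontrivial _ (by simp)
  rw [isSymbolValue_iff_eq_one_add_residueSum nilradical_trunc_pow_four (oneAddEps_sub_one_mem f)
    (oneAddEps_sub_one_mem g) (oneAddEps_sub_one_mem h), residueSum_oneAddEps,
    resWedge_eq_residueSum]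

end TruncatedRing

end ContouCarrere

theorem mainTheorem8 (k : Type*) [Field k] :
    (∀ f g h : (ContouCarrere.DoubleLaurent k)ˣ,
      (∃! c : kˣ, ContouCarrere.IsSymbolValue f g h c) ∧
      ((ContouCarrere.symbol f g h : kˣ) : k) = ContouCarrere.tameSymbol f g h) ∧
    (∀ f g h : ContouCarrere.DoubleLaurent k,
      (∃! c : (ContouCarrere.Trunc k)ˣ, ContouCarrere.IsSymbolValue
        (ContouCarrere.oneAddEps f) (ContouCarrere.oneAddEps g) (ContouCarrere.oneAddEps h) c) ∧
      ((ContouCarrere.symbol (ContouCarrere.oneAddEps f) (ContouCarrere.oneAddEps g)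
        (ContouCarrere.oneAddEps h) : (ContouCarrere.Trunc k)ˣ) : ContouCarrere.Trunc k) =
        1 + ContouCarrere.eps k ^ 3 *
          algebraMap k (ContouCarrere.Trunc k) (ContouCarrere.resWedge f g h)) := by
  refine ⟨fun f g h => ?_, fun f g h => ?_⟩
  · exact ContouCarrere.existsUnique_and_symbol_eq (ContouCarrere.isUnit_tameSymbol f g h)
      ContouCarrere.isSymbolValue_iff_eq_tameSymbol
  · exact ContouCarrere.existsUnique_and_symbol_eq (ContouCarrere.isUnit_one_add_eps _)
      ContouCarrere.isSymbolValue_oneAddEps_iff
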